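/- Let $k$ be a field (not necessarily algebraically closed), let $Q$ be a quiver with vertex set $\{1,\dots,n\}$, let $I\subseteq kQ$ be a two-sided ideal generated by a set of paths of length at least two, and suppose that $A=kQ/I$ is finite-dimensional. For a path $p$ from $s(p)$ to $t(p)$ write products so that $pq$ means first $q$, then $p$; let $e_i\in A$ be the residue class of the trivial path at $i$; a *path in $A$* is a nonzero residue class $p+I$ of a path $p$ of $Q$. All modules are finite-dimensional left modules. Put $P_i=Ae_i$, $L_i=P_i/\operatorname{rad}P_i$, and order the isomorphism classes of simple $A$-modules by $L_i\le L_j :\Leftrightarrow i\le j$. Let $\Delta_i$ be the largest factor module of $P_i$ without composition factors $L_j$, $j>i$. Suppose that $(A,\le)$ is quasi-hereditary, i.e. $A$, as a left $A$-module, has a finite filtration whose subquotients are of the form $\Delta_i$, and $\operatorname{End}_A(\Delta_i)\cong k$ for all $i$. Let $B_{\max}\subseteq A$ be the subalgebra generated by all $e_i$ and all direction-preserving paths, i.e. all paths $p+I$ in $A$ with $s(p)<t(p)$. Call $x\in A$ *right-minimal direction-preserving* if $x\in B_{\max}$ and $x\notin\operatorname{rad}(A)\operatorname{rad}(B_{\max})$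 (so the trivial paths $e_i$ are included), and let $B_{\min}$ be the subalgebra of $A$ generated by all paths in $A$ that are right-minimal direction-preserving. Then $B_{\min}$ has a $k$-basis consisting of paths in $A$, and $B=B_{\min}$ is an exact Borel subalgebra of $(A,\le)$, that is: 1. the functor $A\otimes_B-:\operatorname{mod}B\to\operatorname{mod}A$ is exact; and there is a bijection $\varphi$ from the isomorphism classes of simple $B$-modules to those of simple $A$-modules such that 2. $A\otimes_B L\cong\Delta_i$ whenever $L$ is a simple $B$-module with $\varphi(L)\cong L_i$; 3. $\operatorname{End}_B(L)\cong\operatorname{End}_A(\varphi(L))$ as $k$-algebras for every simple $B$-module $L$; 4. for all simple $B$-modules $L,L'$, if $\operatorname{Ext}^1_B(L,L')\neq0$ then $\varphi(L)\le\varphi(L')$. -/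

import Mathlib

universe u v w

/-! ### Paths and path algebras -/

/-- A path (possibly trivial) in the quiver `V`, together with its source and its target. -/
structure QPath (V : Type v) [Quiver.{w} V] where
  src : V
  tgt : V
  path : Quiver.Path src tgt

namespace QPath

variable {V : Type v} [Quiver.{w} V]

/-- The trivial path at a vertex. -/
def triv (a : V) : QPath V := ⟨a, a, Quiver.Path.nil⟩

/-- The number of arrows of a path. -/
def length (p : QPath V) : ℕ := p.path.length

/-- The path `p * q`, which first runs through `q` and then through `p`,
for paths with `s(p) = t(q)`. -/
def compOf (p q : QPath V) (h : q.tgt = p.src) : QPath V :=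
  ⟨q.src, p.tgt, q.path.comp (p.path.cast h.symm rfl)⟩

theorem compOf_assoc (p q r : QPath V) (h : q.tgt = p.src) (h' : r.tgt = q.src) :
    compOf (compOf p q h) r h' = compOf p (compOf q r h') h := by
  obtain ⟨a, b, p⟩ := p
  obtain ⟨c, d, q⟩ := q
  obtain ⟨e, f, r⟩ := r
  dsimp only at h h'
  subst h h'
  simp [compOf, Quiver.Path.comp_assoc]

theorem triv_compOf (p : QPath V) (a : V) (h : p.tgt = a) : compOf (triv a) p h = p := by
  subst h; rfl

theorem compOf_triv (p : QPath V) (a : V) (h : a = p.src) : compOf p (triv a) h = p := by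
  subst h
  obtain ⟨b, c, p⟩ := p
  simp [compOf, triv]

end QPath

/-- The path algebra `kQ` of the quiver `Q` with vertex set `V`: the vector space with basis the
paths of `Q`. -/
def PathAlgebra (k : Type u) [Field k] (V : Type v) [Quiver.{w} V] := QPath V →₀ k

namespace PathAlgebra

variable (k : Type u) [Field k] (V : Type v) [Quiver.{w} V]

noncomputable instance : AddCommGroup (PathAlgebra k V) :=
  inferInstanceAs (AddCommGroup (QPath V →₀ k))

noncomputable instance : Module k (PathAlgebra k V) :=
  inferInstanceAs (Module k (QPath V →₀ k))

variable {V}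

/-- A path as an element of the path algebra. -/
noncomputable def ofPath (p : QPath V) : PathAlgebra k V := Finsupp.single p (1 : k)

variable {k}

theorem induction_on {P : PathAlgebra k V → Prop} (x : PathAlgebra k V) (zero : P 0)
    (add : ∀ x y, P x → P y → P (x + y)) (smul : ∀ (c : k) (p : QPath V), P (c • ofPath k p)) :
    P x := by
  refine Finsupp.induction_linear (motive := P) x zero add fun p c => ?_
  have h : (Finsupp.single p c : QPath V →₀ k) = c • Finsupp.single p (1 : k) := by simp
  have h' := smul c p
  unfold ofPath at h'
  exact h ▸ h'

variable (k)

open Classical in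
/-- The product of two paths: their concatenation if the second one ends where the first one
starts, and zero otherwise. -/
noncomputable def pathMul (p q : QPath V) : PathAlgebra k V :=
  if h : q.tgt = p.src then ofPath k (QPath.compOf p q h) else 0

variable (V)

/-- The multiplication of the path algebra, as the bilinear extension of the product of paths. -/
noncomputable def mulLin : PathAlgebra k V →ₗ[k] PathAlgebra k V →ₗ[k] PathAlgebra k V :=
  Finsupp.linearCombination k fun p : QPath V =>
    (Finsupp.linearCombination k fun q : QPath V => pathMul k p q :
      PathAlgebra k V →ₗ[k] PathAlgebra k V)

variable {V k}

theorem mulLin_ofPath (p q : QPath V) :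
    mulLin k V (ofPath k p) (ofPath k q) = pathMul k p q := by
  unfold mulLin ofPath
  erw [Finsupp.linearCombination_single, one_smul, Finsupp.linearCombination_single, one_smul]

noncomputable instance : Mul (PathAlgebra k V) := ⟨fun x y => mulLin k V x y⟩

theorem mul_def (x y : PathAlgebra k V) : x * y = mulLin k V x y := rfl

theorem ofPath_mul_ofPath (p q : QPath V) :
    (ofPath k p * ofPath k q : PathAlgebra k V) = pathMul k p q := mulLin_ofPath p q

theorem pathMul_assoc (p q r : QPath V) :
    mulLin k V (pathMul k p q) (ofPath k r) = mulLin k V (ofPath k p) (pathMul k q r) := by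
  by_cases h : q.tgt = p.src <;> by_cases h' : r.tgt = q.src
  · have e1 : pathMul k p q = ofPath k (QPath.compOf p q h) := dif_pos h
    have e2 : pathMul k q r = ofPath k (QPath.compOf q r h') := dif_pos h'
    rw [e1, e2, mulLin_ofPath, mulLin_ofPath]
    have e3 : pathMul k (QPath.compOf p q h) r
        = ofPath k (QPath.compOf (QPath.compOf p q h) r h') := dif_pos h'
    have e4 : pathMul k p (QPath.compOf q r h')
        = ofPath k (QPath.compOf p (QPath.compOf q r h') h) := dif_pos h
    rw [e3, e4, QPath.compOf_assoc]
  · have e1 : pathMul k p q = ofPath k (QPath.compOf p q h) := dif_pos h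
    have e2 : pathMul k q r = 0 := dif_neg h'
    have e3 : pathMul k (QPath.compOf p q h) r = 0 := dif_neg h'
    rw [e1, e2, mulLin_ofPath, map_zero, e3]
  · have e1 : pathMul k p q = 0 := dif_neg h
    have e2 : pathMul k q r = ofPath k (QPath.compOf q r h') := dif_pos h'
    have e4 : pathMul k p (QPath.compOf q r h') = 0 := dif_neg h
    rw [e1, e2, mulLin_ofPath, map_zero, e4, LinearMap.zero_apply]
  · have e1 : pathMul k p q = 0 := dif_neg h
    have e2 : pathMul k q r = 0 := dif_neg h'
    rw [e1, e2, map_zero, map_zero, LinearMap.zero_apply]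

theorem mul_assoc' (x y z : PathAlgebra k V) : x * y * z = x * (y * z) := by
  simp only [mul_def]
  induction x using induction_on with
  | zero => simp
  | add x x' hx hx' => simp only [map_add, LinearMap.add_apply, hx, hx']
  | smul c p =>
    induction y using induction_on with
    | zero => simp
    | add y y' hy hy' => simp only [map_add, LinearMap.add_apply, hy, hy']
    | smul d q =>
      induction z using induction_on with
      | zero => simp
      | add z z' hz hz' => simp only [map_add, hz, hz']
      | smul e r =>
        simp only [map_smul, LinearMap.smul_apply, mulLin_ofPath, pathMul_assoc]

/-- The unit of the path algebra is the sum of the trivial paths. -/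
noncomputable instance [Fintype V] : One (PathAlgebra k V) :=
  ⟨∑ a : V, ofPath k (QPath.triv a)⟩

theorem one_def [Fintype V] : (1 : PathAlgebra k V) = ∑ a : V, ofPath k (QPath.triv a) := rfl

theorem one_mul' [Fintype V] (x : PathAlgebra k V) : 1 * x = x := by
  rw [mul_def, one_def, map_sum, LinearMap.sum_apply]
  induction x using induction_on with
  | zero => simp
  | add x y hx hy => simp only [map_add, Finset.sum_add_distrib, hx, hy]
  | smul c p =>
    simp only [map_smul, mulLin_ofPath, ← Finset.smul_sum]
    congr 1
    rw [Finset.sum_eq_single p.tgt]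
    · have e : pathMul k (QPath.triv p.tgt) p
          = ofPath k (QPath.compOf (QPath.triv p.tgt) p rfl) := dif_pos rfl
      exact e.trans (congrArg (ofPath k) (QPath.triv_compOf p p.tgt rfl))
    · intro a _ ha
      exact dif_neg fun h => ha h.symm
    · intro h
      exact absurd (Finset.mem_univ _) h

theorem mul_one' [Fintype V] (x : PathAlgebra k V) : x * 1 = x := by
  rw [mul_def, one_def, map_sum]
  induction x using induction_on with
  | zero => simp
  | add x y hx hy =>
    simp only [map_add, LinearMap.add_apply, Finset.sum_add_distrib, hx, hy]
  | smul c p =>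
    simp only [map_smul, LinearMap.smul_apply, mulLin_ofPath, ← Finset.smul_sum]
    congr 1
    rw [Finset.sum_eq_single p.src]
    · have e : pathMul k p (QPath.triv p.src)
          = ofPath k (QPath.compOf p (QPath.triv p.src) rfl) := dif_pos rfl
      exact e.trans (congrArg (ofPath k) (QPath.compOf_triv p p.src rfl))
    · intro a _ ha
      exact dif_neg fun h => ha h
    · intro h
      exact absurd (Finset.mem_univ _) h

noncomputable instance [Fintype V] : Ring (PathAlgebra k V) :=
  { (inferInstance : AddCommGroup (PathAlgebra k V)),
    (inferInstance : Mul (PathAlgebra k V)),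
    (inferInstance : One (PathAlgebra k V)) with
    left_distrib := fun x y z => map_add (mulLin k V x) y z
    right_distrib := fun x y z => by
      simp only [mul_def, map_add, LinearMap.add_apply]
    zero_mul := fun x => by simp only [mul_def, map_zero, LinearMap.zero_apply]
    mul_zero := fun x => map_zero (mulLin k V x)
    mul_assoc := mul_assoc'
    one_mul := one_mul'
    mul_one := mul_one' }

noncomputable instance [Fintype V] : Algebra k (PathAlgebra k V) :=
  Algebra.ofModule
    (fun c x y => by
      show mulLin k V (c • x) y = c • mulLin k V x y
      rw [map_smul, LinearMap.smul_apply])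
    (fun c x y => by
      show mulLin k V x (c • y) = c • mulLin k V x y
      rw [map_smul])

end PathAlgebra

/-! ### Modules over a finite-dimensional algebra -/

section Modules

variable {A : Type u} [Ring A]

/-- The left ideal `Ae`; for an idempotent `e` this is the projective module belonging to `e`. -/
abbrev projMod (e : A) : Submodule A A := Submodule.span A {e}

/-- The top `Ae / rad(Ae)` of `Ae`. -/
abbrev topMod (e : A) : Type u := projMod e ⧸ Module.jacobson A (projMod e)

/-- The simple module `L` is a composition factor of `M`, that is, `[M : L] ≠ 0`: it is isomorphic
to a subquotient `N / N'` of `M`. -/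
def IsCompositionFactor (A : Type u) [Ring A] (L : Type v) [AddCommGroup L] [Module A L]
    (M : Type w) [AddCommGroup M] [Module A M] : Prop :=
  ∃ N' N : Submodule A M, N' ≤ N ∧ Nonempty ((N ⧸ N'.submoduleOf N) ≃ₗ[A] L)

variable {ι : Type v} [LinearOrder ι]

/-- The smallest submodule `U` of `P_i = Ae_i` such that `[P_i / U : L_j] = 0` for all `j > i`. -/
def standardKernel (e : ι → A) (i : ι) : Submodule A (projMod (e i)) :=
  sInf {U | ∀ j, i < j → ¬ IsCompositionFactor A (topMod (e j)) (projMod (e i) ⧸ U)}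

/-- The standard module `Δ_i`: the largest factor module of `P_i = Ae_i` that has no composition
factor `L_j` with `j > i`. -/
abbrev standardMod (e : ι → A) (i : ι) : Type u := projMod (e i) ⧸ standardKernel e i

/-- The module `M` has a finite filtration all of whose subquotients are standard modules. -/
def IsStandardlyFiltered (e : ι → A) (M : Type w) [AddCommGroup M] [Module A M] : Prop :=
  ∃ (m : ℕ) (F : ℕ → Submodule A M), F 0 = ⊥ ∧ F m = ⊤ ∧
    ∀ l < m, F l ≤ F (l + 1) ∧
      ∃ i, Nonempty ((F (l + 1) ⧸ (F l).submoduleOf (F (l + 1))) ≃ₗ[A] standardMod e i)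

/-- `A` is quasi-hereditary, where `e` is a complete system of primitive orthogonal idempotents of
`A` such that the `L_i = Ae_i / rad(Ae_i)` are pairwise non-isomorphic, and the simple modules
are ordered like their indices. -/
def IsQuasiHereditary (k : Type w) [Field k] [Algebra k A] (e : ι → A) : Prop :=
  IsStandardlyFiltered e A ∧
    ∀ i, Nonempty (Module.End A (standardMod e i) ≃ₐ[k] k)

/-- Simple left modules. -/
abbrev SimpleMod (R : Type u) [Ring R] : Type (u + 1) :=
  {M : ModuleCat.{u} R // IsSimpleModule R M}

/-- Isomorphism of simple left modules. -/
instance simpleModSetoid (R : Type u) [Ring R] : Setoid (SimpleMod R) where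
  r M N := Nonempty (M.1 ≃ₗ[R] N.1)
  iseqv := ⟨fun M => ⟨LinearEquiv.refl R M.1⟩, fun ⟨f⟩ => ⟨f.symm⟩,
    fun ⟨f⟩ ⟨g⟩ => ⟨f.trans g⟩⟩

/-- The set `Sim(R)` of isomorphism classes of simple left modules. -/
def Sim (R : Type u) [Ring R] : Type (u + 1) := Quotient (simpleModSetoid R)

/-- The isomorphism class of a simple module. -/
def SimpleMod.cls {R : Type u} [Ring R] (M : SimpleMod R) : Sim R := Quotient.mk _ M

/-- The partial order on `Sim(A)`: `L_i ≤ L_j` if and only if `i ≤ j`. -/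
def simLE (e : ι → A) (S T : SimpleMod A) : Prop :=
  ∃ i j, i ≤ j ∧ Nonempty (S.1 ≃ₗ[A] topMod (e i)) ∧ Nonempty (T.1 ≃ₗ[A] topMod (e j))

end Modules

/-! ### Induction and exact Borel subalgebras -/

section Borel

open TensorProduct

variable {k : Type w} [Field k] {A : Type u} [Ring A] [Algebra k A] (B : Subalgebra k A)

/-- The elements `ab ⊗ m - a ⊗ bm` of `A ⊗ M`. -/
def inducedRel (M : Type v) [AddCommGroup M] [Module B M] : Submodule A (A ⊗[ℤ] M) :=
  Submodule.span A
    {x | ∃ (a : A) (b : B) (m : M), x = (a * (b : A)) ⊗ₜ[ℤ] m - a ⊗ₜ[ℤ] (b • m)}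

/-- The left `A`-module `A ⊗_B M` induced by a left `B`-module `M`. -/
abbrev Induced (M : Type v) [AddCommGroup M] [Module B M] := (A ⊗[ℤ] M) ⧸ inducedRel B M

/-- The map `id ⊗ f : A ⊗_B M → A ⊗_B N` induced by `f : M → N`. -/
noncomputable def Induced.map {M N : Type v} [AddCommGroup M] [Module B M] [AddCommGroup N]
    [Module B N] (f : M →ₗ[B] N) : Induced B M →ₗ[A] Induced B N :=
  Submodule.mapQ (inducedRel B M) (inducedRel B N)
    (AlgebraTensorModule.map (LinearMap.id : A →ₗ[A] A) f.toAddMonoidHom.toIntLinearMap) (by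
      refine Submodule.span_le.mpr ?_
      rintro _ ⟨a, b, m, rfl⟩
      refine Submodule.subset_span ⟨a, b, f m, ?_⟩
      simp)

/-- The functor `A ⊗_B -` from finitely generated left `B`-modules to left `A`-modules is exact:
it maps short exact sequences to short exact sequences. -/
def InductionExact : Prop :=
  ∀ (M₁ M₂ M₃ : Type u) [AddCommGroup M₁] [AddCommGroup M₂] [AddCommGroup M₃]
    [Module B M₁] [Module B M₂] [Module B M₃]
    [Module.Finite B M₁] [Module.Finite B M₂] [Module.Finite B M₃]
    (f : M₁ →ₗ[B] M₂) (g : M₂ →ₗ[B] M₃),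
    Function.Injective f → Function.Exact f g → Function.Surjective g →
      Function.Injective (Induced.map B f) ∧
        Function.Exact (Induced.map B f) (Induced.map B g) ∧
        Function.Surjective (Induced.map B g)

open scoped ModuleCat in
/-- `B` is an exact Borel subalgebra of `A`, where the simple `A`-modules are the
`L_i = Ae_i / rad(Ae_i)`, ordered like their indices. -/
def IsExactBorel {ι : Type v} [LinearOrder ι] (e : ι → A) : Prop :=
  InductionExact B ∧
  ∃ φ : Sim B ≃ Sim A,
    (∀ (L : SimpleMod B) (S : SimpleMod A), φ L.cls = S.cls →
      ∃ i, Nonempty (S.1 ≃ₗ[A] topMod (e i)) ∧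
        Nonempty (Induced B L.1 ≃ₗ[A] standardMod e i)) ∧
    (∀ (L : SimpleMod B) (S : SimpleMod A), φ L.cls = S.cls →
      Nonempty (Module.End B L.1 ≃ₐ[k] Module.End A S.1)) ∧
    (∀ (L L' : SimpleMod B) (S S' : SimpleMod A), φ L.cls = S.cls → φ L'.cls = S'.cls →
      Nontrivial (CategoryTheory.Abelian.Ext L.1 L'.1 1) → simLE e S S')

end Borel

/-! ### Monomial algebras -/

section Monomial

variable (k : Type u) [Field k] {V : Type v} [Quiver.{w} V] [Fintype V] (R : Set (QPath V))

/-- The ideal of `kQ` generated by a set of paths. -/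
noncomputable def monomialIdeal : TwoSidedIdeal (PathAlgebra k V) :=
  TwoSidedIdeal.span (PathAlgebra.ofPath k '' R)

/-- The monomial algebra `A = kQ / I`, where `I` is generated by the set `R` of paths. -/
abbrev MonomialAlgebra := (monomialIdeal k R).ringCon.Quotient

/-- The residue class `p + I` of a path `p`. -/
noncomputable def pathClass (p : QPath V) : MonomialAlgebra k R :=
  (monomialIdeal k R).ringCon.toQuotient (PathAlgebra.ofPath k p)

/-- The paths in `A`: the nonzero residue classes of paths of the quiver. -/
def pathsIn : Set (MonomialAlgebra k R) := {x | x ≠ 0 ∧ ∃ p, x = pathClass k R p}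

variable {n : ℕ} (num : V ≃ Fin n)

/-- The idempotent `e_i + I`, where the vertices of the quiver are numbered by `num`. -/
noncomputable def vertexIdem (i : Fin n) : MonomialAlgebra k R := pathClass k R (QPath.triv (num.symm i))

/-- Direction-preserving elements: elements of `e_j A e_i` with `i < j`. -/
def IsDirectionPreserving (x : MonomialAlgebra k R) : Prop :=
  ∃ i j, i < j ∧ ∃ y, x = vertexIdem k R num j * y * vertexIdem k R num i

/-- The subalgebra generated by the trivial paths and the direction-preserving paths. -/
noncomputable def Bmax : Subalgebra k (MonomialAlgebra k R) :=
  Algebra.adjoin k (Set.range (vertexIdem k R num) ∪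
    {x | x ∈ pathsIn k R ∧ IsDirectionPreserving k R num x})

/-- The subspace `rad(A) rad(Bmax)` of `A`. -/
noncomputable def radProduct : Submodule k (MonomialAlgebra k R) :=
  (Ring.jacobson (MonomialAlgebra k R)).restrictScalars k *
    ((Ring.jacobson (Bmax k R num)).restrictScalars k).map (Bmax k R num).val.toLinearMap

/-- Right-minimal direction-preserving elements. The trivial paths satisfy this definition. -/
def IsRightMinimal (x : MonomialAlgebra k R) : Prop :=
  x ∈ Bmax k R num ∧ x ∉ radProduct k R num

/-- The subalgebra generated by the right-minimal direction-preserving paths. -/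
noncomputable def Bmin : Subalgebra k (MonomialAlgebra k R) :=
  Algebra.adjoin k {x | x ∈ pathsIn k R ∧ IsRightMinimal k R num x}

/-- The subalgebra `B` has a basis consisting of paths. -/
def HasPathBasis (B : Subalgebra k (MonomialAlgebra k R)) : Prop :=
  ∃ T ⊆ pathsIn k R, LinearIndepOn k id T ∧ Submodule.span k T = Subalgebra.toSubmodule B

end Monomial

/-! Call a path lower if it never rises above its source, and a record path if its target exceeds
every earlier vertex. Cutting a path at its first visit to its highest vertex writes it, in exactly
one way, as `qr` with `r` record and `q` lower (`exists_lower_record`, `lower_record_unique`). As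
the relations are paths, the nonzero paths form a basis of `A`. In this basis `B_min` is the span of
the record paths (`Bmin_eq`), and the kernel of `P_i → Δ_i` is spanned by the paths from `i` that
rise above `i` (`standardKernel_eq`), so that `Δ_i` has the nonzero lower paths from `i` as a basis.

The crux is that a nonzero lower path composed with a nonzero record path stays nonzero
(`IsGood.compOf`). This follows by counting. The factorization embeds the nonzero paths into the
composable pairs (lower, record). Conversely, let `Δ_j` occur `m_j` times in a standard filtration
of `A`. Then `dim A` is at least the sum over `j` of `m_j` times the number of lower paths from `j`
(`sum_card_lowerFrom_le`). Moreover `m_j` is at least the number of record paths to `j`, since `e_j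
A` is spanned by `m_j` elements modulo paths rising above `j` (`vertexIdem_mul_mem_of_filtration`,
`card_recordTo_le`); this uses `End(Δ_j) ≅ k`. So there are no more pairs than paths, and the
embedding is a bijection.

Hence `A` is the direct sum of the right `B`-modules `qB`, over the nonzero lower paths `q`, with
`qB ≅ e_{s(q)}B`. It is therefore projective over `B`, with an explicit dual basis
(`isDualBasis_lowerCoord`), and induction is exact. The module induced from the simple module at `i`
is `P_i` modulo the paths rising above `i`, which is `Δ_i` (`exists_induced_equiv`). The simple
modules of `A` and of `B` are one-dimensional and labelled by the vertices, and the radical of `B`,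
spanned by nontrivial record paths, leads only from smaller to larger vertices; this gives the
remaining conditions. -/

namespace QPath

/-! ### Combinatorics of paths: lower paths and record paths -/

variable {V : Type v} [Quiver.{w} V]

@[simp] theorem compOf_src (p q : QPath V) (h : q.tgt = p.src) : (compOf p q h).src = q.src := rfl

@[simp] theorem compOf_tgt (p q : QPath V) (h : q.tgt = p.src) : (compOf p q h).tgt = p.tgt := rfl

@[simp] theorem triv_src (a : V) : (triv a).src = a := rfl

@[simp] theorem triv_tgt (a : V) : (triv a).tgt = a := rfl

@[simp] theorem length_triv (a : V) : (triv a).length = 0 := rfl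

@[simp] theorem length_compOf (p q : QPath V) (h : q.tgt = p.src) :
    (compOf p q h).length = q.length + p.length := by
  obtain ⟨a, b, p⟩ := p
  obtain ⟨c, d, q⟩ := q
  dsimp only at h
  subst h
  simp [compOf, length]

theorem eq_triv_of_length_eq_zero (p : QPath V) (h : p.length = 0) : p = triv p.src := by
  obtain ⟨a, b, p⟩ := p
  obtain rfl := Quiver.Path.eq_of_length_zero p h
  obtain rfl := Quiver.Path.eq_nil_of_length_zero p h
  rfl

theorem exists_compOf_eq (p : QPath V) {m : ℕ} (hm : m ≤ p.length) :
    ∃ (q r : QPath V) (h : r.tgt = q.src), compOf q r h = p ∧ r.length = m := by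
  obtain ⟨a, b, p⟩ := p
  obtain ⟨c, r, q, rfl, hr⟩ := p.exists_eq_comp_of_le_length hm
  exact ⟨⟨c, b, q⟩, ⟨a, c, r⟩, rfl, rfl, hr⟩

theorem compOf_inj {q r q' r' : QPath V} {h : r.tgt = q.src} {h' : r'.tgt = q'.src}
    (e : compOf q r h = compOf q' r' h') (hl : r.length = r'.length) : q = q' ∧ r = r' := by
  obtain ⟨a, b, q⟩ := q
  obtain ⟨c, d, r⟩ := r
  obtain ⟨a', b', q'⟩ := q'
  obtain ⟨c', d', r'⟩ := r'
  dsimp only at h h'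
  subst h h'
  simp only [compOf, Quiver.Path.cast_rfl_rfl, mk.injEq] at e
  obtain ⟨rfl, rfl, e⟩ := e
  have e := eq_of_heq e
  simp only [length] at hl
  -- The cut vertex is read off the vertex list of the common path, at the position given by the
  -- length of the initial segment. Only after this identification do the two factorizations have
  -- comparable types.
  have hd : d = d' := by
    have h1 := Quiver.Path.vertices_comp_get_length_eq r q (by simp)
    have h2 := Quiver.Path.vertices_comp_get_length_eq r' q' (by simp)
    simp only [List.get_eq_getElem] at h1 h2
    rw [← h1, ← h2]
    simp only [e, hl]
  subst hd
  obtain ⟨rfl, rfl⟩ := Quiver.Path.comp_inj' hl |>.mp e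
  exact ⟨rfl, rfl⟩

/-- Levi's lemma: of two initial segments of a path, the shorter one is an initial segment of the
longer one. -/
theorem exists_compOf_of_length_le {q r q' r' : QPath V} {h : r.tgt = q.src}
    {h' : r'.tgt = q'.src} (e : compOf q r h = compOf q' r' h') (hl : r.length ≤ r'.length) :
    ∃ (s : QPath V) (h₁ : r.tgt = s.src) (h₂ : s.tgt = q'.src),
      r' = compOf s r h₁ ∧ q = compOf q' s h₂ := by
  obtain ⟨s, r₁, h₁, rfl, hr₁⟩ := exists_compOf_eq r' hl
  rw [← compOf_assoc q' s r₁ h' h₁] at e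
  obtain ⟨rfl, rfl⟩ := compOf_inj e hr₁.symm
  exact ⟨s, h₁, h', rfl, rfl⟩

variable {n : ℕ} (num : V ≃ Fin n)

/-- The path runs through a vertex whose number is larger than `i`. -/
def RisesAbove (i : Fin n) (p : QPath V) : Prop :=
  ∃ (q r : QPath V) (h : r.tgt = q.src), compOf q r h = p ∧ i < num r.tgt

/-- No vertex of the path is larger than its source. -/
def IsLower (p : QPath V) : Prop :=
  ∀ (q r : QPath V) (h : r.tgt = q.src), compOf q r h = p → num r.tgt ≤ num p.src

/-- The target of the path is larger than all earlier vertices. -/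
def IsRecord (p : QPath V) : Prop :=
  ∀ (q r : QPath V) (h : r.tgt = q.src), compOf q r h = p → 0 < q.length → num r.tgt < num p.tgt

variable {num}

theorem isLower_iff {p : QPath V} : IsLower num p ↔ ¬ RisesAbove num (num p.src) p := by
  simp [IsLower, RisesAbove]

theorem RisesAbove.compOf_left {i : Fin n} {r : QPath V} (hr : RisesAbove num i r) (q : QPath V)
    (h : r.tgt = q.src) : RisesAbove num i (compOf q r h) := by
  obtain ⟨s, t, h', rfl, ht⟩ := hr
  exact ⟨compOf q s h, t, h', compOf_assoc _ _ _ _ _, ht⟩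

theorem RisesAbove.compOf_right {i : Fin n} {q : QPath V} (hq : RisesAbove num i q) (r : QPath V)
    (h : r.tgt = q.src) : RisesAbove num i (compOf q r h) := by
  obtain ⟨s, t, h', rfl, ht⟩ := hq
  exact ⟨s, compOf t r h, h', (compOf_assoc _ _ _ _ _).symm, ht⟩

theorem risesAbove_of_tgt {i : Fin n} {p : QPath V} (h : i < num p.tgt) : RisesAbove num i p :=
  ⟨triv p.tgt, p, rfl, triv_compOf _ _ rfl, h⟩

theorem compOf_eq_triv {q r : QPath V} {h : r.tgt = q.src} {a : V} (e : compOf q r h = triv a) :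
    q = triv a ∧ r = triv a := by
  have hl := congrArg length e
  rw [length_compOf, length_triv] at hl
  have hr := eq_triv_of_length_eq_zero r (by omega)
  have hq := eq_triv_of_length_eq_zero q (by omega)
  have h1 : r.src = a := congrArg src e
  have h2 : q.tgt = a := congrArg tgt e
  have h3 : q.tgt = q.src := by rw [hq]; rfl
  rw [h1] at hr
  rw [← h3, h2] at hq
  exact ⟨hq, hr⟩

theorem isRecord_triv (a : V) : IsRecord num (triv a) := by
  intro q r h e hq
  rw [(compOf_eq_triv e).1] at hq
  exact absurd hq (lt_irrefl _)

theorem IsRecord.src_lt {p : QPath V} (hp : IsRecord num p) (h : 0 < p.length) :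
    num p.src < num p.tgt :=
  hp p (triv p.src) rfl (compOf_triv _ _ rfl) h

theorem IsRecord.src_le {p : QPath V} (hp : IsRecord num p) : num p.src ≤ num p.tgt := by
  rcases Nat.eq_zero_or_pos p.length with h | h
  · rw [eq_triv_of_length_eq_zero p h]; rfl
  · exact (hp.src_lt h).le

theorem IsRecord.initial_le {p q r : QPath V} (hp : IsRecord num p) {h : r.tgt = q.src}
    (e : compOf q r h = p) : num r.tgt ≤ num p.tgt := by
  rcases Nat.eq_zero_or_pos q.length with h' | h'
  · subst e
    rw [h, compOf_tgt, eq_triv_of_length_eq_zero q h']; rfl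
  · exact (hp q r h e h').le

/-- A vertex met along `q` is at most `t(q) = s(p)`, hence below `t(p)` once `p` is nontrivial;
later vertices are controlled by `p`. This makes the span of the record paths a subalgebra. -/
theorem IsRecord.compOf {p q : QPath V} (hp : IsRecord num p) (hq : IsRecord num q)
    (h : q.tgt = p.src) : IsRecord num (compOf p q h) := by
  intro s t h' e hs
  rcases le_total t.length q.length with hl | hl
  · obtain ⟨x, h₁, h₂, rfl, rfl⟩ := exists_compOf_of_length_le e hl
    rcases Nat.eq_zero_or_pos p.length with h0 | h0
    · have hx : 0 < x.length := by
        rw [length_compOf] at hs; omega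
      have := hq x t h₁ rfl hx
      refine this.trans_le ?_
      rw [h]; exact hp.src_le
    · calc num t.tgt ≤ num (QPath.compOf x t h₁).tgt := hq.initial_le rfl
        _ = num p.src := by rw [h]
        _ < num p.tgt := hp.src_lt h0
  · obtain ⟨x, h₁, h₂, rfl, rfl⟩ := exists_compOf_of_length_le e.symm hl
    exact hp s x h₂ rfl hs

theorem IsRecord.of_compOf_left {p q : QPath V} {h : q.tgt = p.src}
    (H : IsRecord num (QPath.compOf p q h)) : IsRecord num p := by
  rintro s t h' rfl hs
  exact H s (QPath.compOf t q h) h' (compOf_assoc _ _ _ _ _).symm hs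

/-- Every path runs upwards to its highest vertex first, and stays below that vertex afterwards. -/
theorem exists_lower_record (num : V ≃ Fin n) (p : QPath V) :
    ∃ (q r : QPath V) (h : r.tgt = q.src),
      QPath.compOf q r h = p ∧ IsLower num q ∧ IsRecord num r := by
  classical
  -- `M` is the highest vertex on `p`, and the cut is made at the first visit to it. Maximality of
  -- `M` makes the rest lower; minimality of the initial segment makes that segment a record path.
  obtain ⟨M, ⟨q₀, r₀, h₀, e₀, hM₀⟩, hM⟩ : ∃ M : Fin n,
      (∃ (q r : QPath V) (h : r.tgt = q.src), QPath.compOf q r h = p ∧ num r.tgt = M) ∧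
      ∀ (q r : QPath V) (h : r.tgt = q.src), QPath.compOf q r h = p → num r.tgt ≤ M := by
    let S : Set (Fin n) :=
      {M | ∃ (q r : QPath V) (h : r.tgt = q.src), QPath.compOf q r h = p ∧ num r.tgt = M}
    have hS : S.Nonempty := ⟨_, p, triv p.src, rfl, compOf_triv _ _ rfl, rfl⟩
    obtain ⟨M, hM⟩ := S.toFinite.exists_maximal hS
    refine ⟨M, hM.1, fun q r h e => ?_⟩
    have := hM.2 (y := num r.tgt) ⟨q, r, h, e, rfl⟩
    rcases le_total (num r.tgt) M with h | h
    · exact h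
    · exact this h
  have hex : ∃ m, ∃ (q r : QPath V) (h : r.tgt = q.src),
      QPath.compOf q r h = p ∧ num r.tgt = M ∧ r.length = m :=
    ⟨_, q₀, r₀, h₀, e₀, hM₀, rfl⟩
  obtain ⟨q, r, h, rfl, hr, hl⟩ := Nat.find_spec hex
  refine ⟨q, r, h, rfl, ?_, ?_⟩
  · rintro s t h' rfl
    rw [← h, hr]
    exact hM s (QPath.compOf t r h) h' (compOf_assoc _ _ _ _ _).symm
  · rintro s t h' rfl hs
    refine lt_of_le_of_ne (hr ▸ hM (QPath.compOf q s h) t h' (compOf_assoc _ _ _ _ _)) fun he => ?_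
    refine Nat.find_min hex (m := t.length) ?_
      ⟨QPath.compOf q s h, t, h', compOf_assoc _ _ _ _ _, he.trans hr, rfl⟩
    rw [← hl, length_compOf]
    omega

/-- If the two cuts differed, the piece between them would climb strictly, as the end of a record
path, and could not climb, as the beginning of a lower one. -/
theorem lower_record_unique {q r q' r' : QPath V} {h : r.tgt = q.src} {h' : r'.tgt = q'.src}
    (e : QPath.compOf q r h = QPath.compOf q' r' h') (hq : IsLower num q) (hr : IsRecord num r)
    (hq' : IsLower num q') (hr' : IsRecord num r') : q = q' ∧ r = r' := by
  have key : ∀ {q r q' r' : QPath V} {h : r.tgt = q.src} {h' : r'.tgt = q'.src},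
      QPath.compOf q r h = QPath.compOf q' r' h' → IsLower num q → IsRecord num r' →
      r.length ≤ r'.length → r.length = r'.length := by
    intro q r q' r' h h' e hq hr' hl
    obtain ⟨s, h₁, h₂, rfl, rfl⟩ := exists_compOf_of_length_le e hl
    rcases Nat.eq_zero_or_pos s.length with h0 | h0
    · rw [length_compOf, h0, add_zero]
    · have h3 := hr' s r h₁ rfl h0
      have h4 := hq q' s h₂ rfl
      rw [compOf_tgt] at h3
      rw [compOf_src, ← h₁] at h4
      exact absurd h3 h4.not_gt
  refine compOf_inj e ?_
  rcases le_total r.length r'.length with hl | hl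
  · exact key e hq hr' hl
  · exact (key e.symm hq' hr hl).symm

end QPath

/-! ### Split basic algebras: radical, simple modules, first extensions -/

section SplitBasic

/-- The family `e` is a complete system of orthogonal idempotents of `A`, and `A` is the sum of
the lines `k e_i` and of a two-sided nil ideal `J`. -/
structure IsSplitBasic (k : Type w) [Field k] {A : Type u} [Ring A] [Algebra k A] {ι : Type v}
    [Fintype ι] (e : ι → A) (J : Ideal A) : Prop where
  idem : CompleteOrthogonalIdempotents e
  ne_zero : ∀ i, e i ≠ 0
  mul_mem : ∀ x ∈ J, ∀ a, x * a ∈ J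
  nil : ∀ x ∈ J, IsNilpotent x
  exists_sub_mem : ∀ a, ∃ c : ι → k, a - ∑ i, c i • e i ∈ J

namespace IsSplitBasic

variable {k : Type w} [Field k] {A : Type u} [Ring A] [Algebra k A] {ι : Type v} [Fintype ι]
  {e : ι → A} {J : Ideal A} (h : IsSplitBasic k e J)

include h

theorem mul_self (i : ι) : e i * e i = e i := h.idem.idem i

theorem mul_of_ne {i j : ι} (hij : i ≠ j) : e i * e j = 0 := h.idem.ortho hij

omit [Fintype ι] h in
theorem smul_mem (c : k) {x : A} (hx : x ∈ J) : c • x ∈ J := by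
  rw [Algebra.smul_def]; exact J.mul_mem_left _ hx

theorem notMem (i : ι) : e i ∉ J := fun hi => by
  obtain ⟨m, hm⟩ := h.nil _ hi
  have : ∀ m : ℕ, e i ^ (m + 1) = e i := fun m => by
    induction m with
    | zero => simp
    | succ m ih => rw [pow_succ, ih, h.mul_self]
  apply h.ne_zero i
  rw [← this m, pow_succ, hm, zero_mul]

theorem sum_mul (c : ι → k) (i : ι) : (∑ j, c j • e j) * e i = c i • e i := by
  classical
  rw [Finset.sum_mul, Finset.sum_eq_single i]
  · rw [smul_mul_assoc, h.mul_self]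
  · intro j _ hj
    rw [smul_mul_assoc, h.mul_of_ne hj, smul_zero]
  · simp

theorem exists_mul_sub_mem (a : A) (i : ι) : ∃ c : k, a * e i - c • e i ∈ J := by
  obtain ⟨c, hc⟩ := h.exists_sub_mem a
  refine ⟨c i, ?_⟩
  rw [← h.sum_mul c i, ← sub_mul]
  exact h.mul_mem _ hc _

theorem mul_mem_of_ne {i j : ι} (hij : j ≠ i) (a : A) : e j * (a * e i) ∈ J := by
  obtain ⟨c, hc⟩ := h.exists_mul_sub_mem a i
  have := J.mul_mem_left (e j) hc
  rwa [mul_sub, mul_smul_comm, h.mul_of_ne hij, smul_zero, sub_zero] at this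

/-- A nil left ideal lies in the radical. Conversely, an element of the radical is `∑ c_i e_i`
modulo `J`, and cutting with `e_i` puts `c_i e_i` into the radical, which is impossible for `c_i ≠
0` because `e_i` is a nonzero idempotent. -/
theorem ringJacobson_eq : Ring.jacobson A = J := by
  rw [← Ideal.jacobson_bot]
  apply le_antisymm
  · intro x hx
    obtain ⟨c, hc⟩ := h.exists_sub_mem x
    have hJ : J ≤ (⊥ : Ideal A).jacobson := by
      intro y hy
      rw [Ideal.mem_jacobson_iff]
      intro z
      obtain ⟨u, hu⟩ := (h.nil _ (J.mul_mem_left z hy)).isUnit_one_add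
      refine ⟨↑u⁻¹, ?_⟩
      have : (↑u⁻¹ : A) * (1 + z * y) = 1 := by rw [← hu]; simp
      rw [Ideal.mem_bot, ← this]
      noncomm_ring
    have h0 : ∀ i, c i = 0 := by
      intro i
      by_contra hi
      have h1 : e i * x - c i • e i ∈ (⊥ : Ideal A).jacobson := by
        have h2 := hJ (J.mul_mem_left (e i) hc)
        have h3 : e i * ∑ j, c j • e j = c i • e i := by
          classical
          rw [Finset.mul_sum, Finset.sum_eq_single i]
          · rw [mul_smul_comm, h.mul_self]
          · intro j _ hj
            rw [mul_smul_comm, h.mul_of_ne hj.symm, smul_zero]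
          · simp
        rwa [mul_sub, h3] at h2
      have h2 : c i • e i ∈ (⊥ : Ideal A).jacobson := by
        have := sub_mem (Ideal.mul_mem_left _ (e i) hx) h1
        rwa [sub_sub_cancel] at this
      -- The multiplier `-c_i⁻¹` turns the radical condition into `-z e_i + z - 1 = 0`; multiplying
      -- by `e_i` on the right leaves `e_i = 0`.
      obtain ⟨z, hz⟩ := Ideal.mem_jacobson_iff.mp h2 (algebraMap k A (-(c i)⁻¹))
      have h3 : algebraMap k A (-(c i)⁻¹) * c i • e i = - e i := by
        rw [← Algebra.smul_def, smul_smul, neg_mul, inv_mul_cancel₀ hi, neg_one_smul]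
      rw [Ideal.mem_bot, mul_assoc, h3] at hz
      apply h.ne_zero i
      have h4 := congrArg (· * e i) hz
      simp only [sub_mul, add_mul, mul_neg, neg_mul, mul_assoc, h.mul_self, one_mul, zero_mul,
        neg_add_cancel, zero_sub, neg_eq_zero] at h4
      exact h4
    simpa [h0] using hc
  · intro y hy
    rw [Ideal.mem_jacobson_iff]
    intro z
    obtain ⟨u, hu⟩ := (h.nil _ (J.mul_mem_left z hy)).isUnit_one_add
    refine ⟨↑u⁻¹, ?_⟩
    have : (↑u⁻¹ : A) * (1 + z * y) = 1 := by rw [← hu]; simp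
    rw [Ideal.mem_bot, ← this]
    noncomm_ring

omit h in
theorem mem_projMod {a : A} {x : A} : x ∈ projMod a ↔ ∃ b, x = b * a := by
  rw [projMod, Submodule.mem_span_singleton]
  simp [eq_comm]

omit h in
theorem self_mem_projMod (a : A) : a ∈ projMod a := Submodule.mem_span_singleton_self a

theorem mul_eq_of_mem_projMod {i : ι} {x : A} (hx : x ∈ projMod (e i)) : x * e i = x := by
  obtain ⟨b, rfl⟩ := mem_projMod.mp hx
  rw [mul_assoc, h.mul_self]

theorem exists_sub_mem_of_mem_projMod {i : ι} {x : A} (hx : x ∈ projMod (e i)) :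
    ∃ c : k, x - c • e i ∈ J := by
  rw [← h.mul_eq_of_mem_projMod hx]
  exact h.exists_mul_sub_mem x i

/-- A proper submodule of `Ae_i` is contained in `J`. -/
theorem le_submoduleOf_of_ne_top {i : ι} {N : Submodule A (projMod (e i))} (hN : N ≠ ⊤) :
    N ≤ J.submoduleOf (projMod (e i)) := by
  intro x hx
  obtain ⟨c, hc⟩ := h.exists_sub_mem_of_mem_projMod x.2
  rcases eq_or_ne c 0 with rfl | h0
  · rw [zero_smul, sub_zero] at hc
    exact hc
  refine absurd ?_ hN
  -- For `c ≠ 0`, the element `c⁻¹ x` is a unit (one plus a nilpotent) times `e_i`, so a submodule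
  -- containing `x` contains the generator.
  have hmem : (⟨e i, self_mem_projMod _⟩ : projMod (e i)) ∈ N := by
    obtain ⟨u, hu⟩ := (h.nil _ (smul_mem c⁻¹ hc)).isUnit_one_add
    have h1 : (1 + c⁻¹ • ((x : A) - c • e i)) * e i = c⁻¹ • (x : A) := by
      rw [add_mul, one_mul, smul_mul_assoc, sub_mul, h.mul_eq_of_mem_projMod x.2, smul_mul_assoc,
        h.mul_self, smul_sub, smul_smul, inv_mul_cancel₀ h0, one_smul, add_sub_cancel]
    have h2 : e i = ((↑u⁻¹ : A) * algebraMap k A c⁻¹) * (x : A) := by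
      rw [mul_assoc, ← Algebra.smul_def, ← h1, ← hu, ← mul_assoc]
      simp
    have h3 := N.smul_mem ((↑u⁻¹ : A) * algebraMap k A c⁻¹) hx
    have h4 : (⟨e i, self_mem_projMod _⟩ : projMod (e i)) =
        ((↑u⁻¹ : A) * algebraMap k A c⁻¹) • x := Subtype.ext h2
    rwa [h4]
  rw [eq_top_iff]
  rintro ⟨y, hy⟩ -
  obtain ⟨b, rfl⟩ := mem_projMod.mp hy
  exact N.smul_mem b hmem

theorem submoduleOf_ne_top (i : ι) : J.submoduleOf (projMod (e i)) ≠ ⊤ := fun ht =>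
  h.notMem i (by
    have : (⟨e i, self_mem_projMod _⟩ : projMod (e i)) ∈ J.submoduleOf (projMod (e i)) := by
      rw [ht]; trivial
    exact this)

theorem isCoatom_submoduleOf (i : ι) : IsCoatom (J.submoduleOf (projMod (e i))) :=
  ⟨h.submoduleOf_ne_top i, fun N hN => by
    by_contra hN'
    exact hN.not_ge (h.le_submoduleOf_of_ne_top hN')⟩

theorem jacobson_projMod (i : ι) :
    Module.jacobson A (projMod (e i)) = J.submoduleOf (projMod (e i)) := by
  apply le_antisymm
  · exact sInf_le (h.isCoatom_submoduleOf i)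
  · refine le_sInf fun N hN => ?_
    rcases (h.le_submoduleOf_of_ne_top hN.1).eq_or_lt with heq | hlt
    · exact heq.ge
    · exact absurd (hN.2 _ hlt) (h.submoduleOf_ne_top i)

theorem isSimpleModule_topMod (i : ι) : IsSimpleModule A (topMod (e i)) := by
  rw [isSimpleModule_iff_isCoatom, h.jacobson_projMod]
  exact h.isCoatom_submoduleOf i

section Modules

variable {M : Type*} [AddCommGroup M] [Module A M]

omit h [Fintype ι] in
/-- The map `Ae → M` that sends `a` to `ax`. -/
noncomputable def projMap (a : A) (x : M) : projMod a →ₗ[A] M :=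
  (LinearMap.toSpanSingleton A M x).domRestrict (projMod a)

omit h [Fintype ι] in
@[simp] theorem projMap_apply (a : A) (x : M) (y : projMod a) : projMap a x y = (y : A) • x := rfl

theorem ker_projMap_le {i : ι} {x : M} (hx : e i • x = x) (h0 : x ≠ 0) :
    LinearMap.ker (projMap (e i) x) ≤ J.submoduleOf (projMod (e i)) := by
  apply h.le_submoduleOf_of_ne_top
  intro ht
  apply h0
  have : (⟨e i, self_mem_projMod _⟩ : projMod (e i)) ∈ LinearMap.ker (projMap (e i) x) := by
    rw [ht]; trivial
  rw [LinearMap.mem_ker, projMap_apply] at this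
  rwa [hx] at this

theorem mul_mem_of_smul_eq_zero {i : ι} {x : M} (hx : e i • x = x) (h0 : x ≠ 0) {b : A}
    (hb : b • x = 0) : b * e i ∈ J := by
  have : (⟨b * e i, mem_projMod.mpr ⟨b, rfl⟩⟩ : projMod (e i)) ∈
      LinearMap.ker (projMap (e i) x) := by
    rw [LinearMap.mem_ker, projMap_apply, mul_smul, hx, hb]
  exact h.ker_projMap_le hx h0 this

omit [Fintype ι] h in
theorem projMap_surjective [IsSimpleModule A M] {i : ι} {x : M} (hx : e i • x = x) (h0 : x ≠ 0) :
    Function.Surjective (projMap (e i) x) := by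
  intro y
  obtain ⟨a, rfl⟩ := IsSimpleModule.toSpanSingleton_surjective A h0 y
  refine ⟨⟨a * e i, mem_projMod.mpr ⟨a, rfl⟩⟩, ?_⟩
  simp [mul_smul, hx]

theorem ker_projMap [IsSimpleModule A M] {i : ι} {x : M} (hx : e i • x = x) (h0 : x ≠ 0) :
    LinearMap.ker (projMap (e i) x) = J.submoduleOf (projMod (e i)) := by
  rcases (h.ker_projMap_le hx h0).eq_or_lt with heq | hlt
  · exact heq
  · exact absurd ((LinearMap.isCoatom_ker_of_surjective (projMap_surjective hx h0)).2 _ hlt)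
      (h.submoduleOf_ne_top i)

theorem smul_eq_zero_of_mem [IsSimpleModule A M] {i : ι} {x : M} (hx : e i • x = x) (h0 : x ≠ 0)
    {a : A} (ha : a ∈ J) : a • x = 0 := by
  have : (⟨a * e i, mem_projMod.mpr ⟨a, rfl⟩⟩ : projMod (e i)) ∈
      LinearMap.ker (projMap (e i) x) := by
    rw [h.ker_projMap hx h0]
    exact h.mul_mem a ha _
  simpa [mul_smul, hx] using this

theorem exists_smul_eq [IsSimpleModule A M] {i : ι} {x : M} (hx : e i • x = x) (h0 : x ≠ 0)
    (y : M) : ∃ c : k, y = algebraMap k A c • x := by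
  obtain ⟨⟨a, ha⟩, rfl⟩ := projMap_surjective hx h0 y
  obtain ⟨c, hc⟩ := h.exists_sub_mem_of_mem_projMod ha
  refine ⟨c, ?_⟩
  have := h.smul_eq_zero_of_mem hx h0 hc
  rw [sub_smul, sub_eq_zero, Algebra.smul_def, mul_smul, hx] at this
  exact this

theorem smul_eq_zero_of_ne [IsSimpleModule A M] {i j : ι} (hij : j ≠ i) {x : M} (hx : e i • x = x)
    (h0 : x ≠ 0) (y : M) : e j • y = 0 := by
  obtain ⟨⟨a, ha⟩, rfl⟩ := projMap_surjective hx h0 y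
  obtain ⟨b, rfl⟩ := mem_projMod.mp ha
  rw [projMap_apply, ← mul_smul]
  exact h.smul_eq_zero_of_mem hx h0 (h.mul_mem_of_ne hij b)

theorem exists_topMod_equiv [IsSimpleModule A M] {i : ι} {x : M} (hx : e i • x = x) (h0 : x ≠ 0) :
    Nonempty (M ≃ₗ[A] topMod (e i)) :=
  ⟨((Submodule.quotEquivOfEq _ _ ((h.jacobson_projMod i).trans (h.ker_projMap hx h0).symm)).trans
    ((projMap (e i) x).quotKerEquivOfSurjective (projMap_surjective hx h0))).symm⟩

theorem exists_smul_ne_zero {x : M} (hx : x ≠ 0) : ∃ i, e i • x ≠ 0 := by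
  by_contra! hc
  apply hx
  rw [← one_smul A x, ← h.idem.complete, Finset.sum_smul]
  exact Finset.sum_eq_zero fun i _ => hc i

theorem exists_smul_eq_self [IsSimpleModule A M] : ∃ i, ∃ x : M, e i • x = x ∧ x ≠ 0 := by
  have := IsSimpleModule.nontrivial A M
  obtain ⟨x, hx⟩ := exists_ne (0 : M)
  obtain ⟨i, hi⟩ := h.exists_smul_ne_zero hx
  exact ⟨i, e i • x, by rw [← mul_smul, h.mul_self], hi⟩

/-- A simple module is a line `k x` with `e_i x = x`, so an endomorphism is the scalar by which it
acts on `x`; `k` need not be algebraically closed. -/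
theorem end_algebraMap_bijective [Module k M] [IsScalarTower k A M] [IsSimpleModule A M] :
    Function.Bijective (algebraMap k (Module.End A M)) := by
  have := IsSimpleModule.nontrivial A M
  refine ⟨RingHom.injective _, fun f => ?_⟩
  obtain ⟨i, x, hx, h0⟩ := h.exists_smul_eq_self (M := M)
  obtain ⟨c, hc⟩ := h.exists_smul_eq hx h0 (f x)
  refine ⟨c, ?_⟩
  ext y
  obtain ⟨a, rfl⟩ := IsSimpleModule.toSpanSingleton_surjective A h0 y
  rw [Module.algebraMap_end_apply, LinearMap.toSpanSingleton_apply, map_smul, hc, ← mul_smul,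
    ← Algebra.commutes, mul_smul, algebraMap_smul]

end Modules

/-- The generator of the top of `Ae_i`. -/
theorem topMod_generator (i : ι) :
    ∃ x : topMod (e i), e i • x = x ∧ x ≠ 0 := by
  refine ⟨Submodule.Quotient.mk ⟨e i, self_mem_projMod _⟩, ?_, ?_⟩
  · rw [← Submodule.Quotient.mk_smul]
    congr 1
    exact Subtype.ext (h.mul_self i)
  · rw [Ne, Submodule.Quotient.mk_eq_zero, h.jacobson_projMod]
    exact h.notMem i

theorem eq_of_topMod_equiv {i j : ι} (φ : topMod (e i) ≃ₗ[A] topMod (e j)) : i = j := by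
  by_contra hij
  obtain ⟨x, hx, h0⟩ := h.topMod_generator i
  obtain ⟨y, hy, h1⟩ := h.topMod_generator j
  have := h.isSimpleModule_topMod j
  apply h0
  rw [← φ.map_eq_zero_iff, ← hx, map_smul]
  exact h.smul_eq_zero_of_ne hij hy h1 _

/-- If `e_j` kills `M` it kills every subquotient, but not `L_j`. If `e_j x ≠ 0`, then `A e_j x / J
e_j x` is a copy of `L_j`, because the kernel of `Ae_j → A e_j x` is proper and so lies in `J`. -/
theorem isCompositionFactor_topMod_iff {M : Type*} [AddCommGroup M] [Module A M] (j : ι) :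
    IsCompositionFactor A (topMod (e j)) M ↔ ∃ x : M, e j • x ≠ 0 := by
  constructor
  · rintro ⟨N', N, hN, ⟨φ⟩⟩
    by_contra! hc
    obtain ⟨y, hy, h1⟩ := h.topMod_generator j
    apply h1
    rw [← φ.symm.map_eq_zero_iff, ← hy, map_smul]
    obtain ⟨z, hz⟩ := Submodule.Quotient.mk_surjective _ (φ.symm y)
    rw [← hz, ← Submodule.Quotient.mk_smul]
    have : e j • z = 0 := Subtype.ext (hc z)
    rw [this, Submodule.Quotient.mk_zero]
  · rintro ⟨x, hx⟩
    have hy : e j • (e j • x) = e j • x := by rw [← mul_smul, h.mul_self]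
    let π := projMap (e j) (e j • x)
    let N := LinearMap.range π
    let N' := (J.submoduleOf (projMod (e j))).map π
    let ψ : projMod (e j) →ₗ[A] N ⧸ N'.submoduleOf N :=
      (N'.submoduleOf N).mkQ ∘ₗ π.rangeRestrict
    have hψ : Function.Surjective ψ :=
      (Submodule.mkQ_surjective _).comp π.surjective_rangeRestrict
    have hker : LinearMap.ker ψ = J.submoduleOf (projMod (e j)) := by
      ext z
      rw [LinearMap.mem_ker, LinearMap.comp_apply, Submodule.mkQ_apply,
        Submodule.Quotient.mk_eq_zero]
      constructor
      · rintro ⟨z', hz', hzz⟩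
        have h1 : z - z' ∈ LinearMap.ker π := by
          rw [LinearMap.mem_ker, map_sub, hzz]
          exact sub_self _
        have h2 := add_mem (h.ker_projMap_le hy hx h1) hz'
        rwa [sub_add_cancel] at h2
      · intro hz
        exact ⟨z, hz, rfl⟩
    exact ⟨N', N, LinearMap.map_le_range, ⟨((Submodule.quotEquivOfEq _ _
      ((h.jacobson_projMod j).trans hker.symm)).trans
      (ψ.quotKerEquivOfSurjective hψ)).symm⟩⟩

/-- The simple modules are numbered by the idempotents. -/
noncomputable def simEquiv : ι ≃ Sim A :=
  Equiv.ofBijective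
    (fun i => SimpleMod.cls ⟨ModuleCat.of A (topMod (e i)), h.isSimpleModule_topMod i⟩) <| by
    constructor
    · intro i j hij
      obtain ⟨φ⟩ := Quotient.exact hij
      exact h.eq_of_topMod_equiv φ
    · intro S
      obtain ⟨⟨S, hS⟩, rfl⟩ := Quotient.exists_rep S
      have : IsSimpleModule A S := hS
      obtain ⟨i, x, hx, h0⟩ := h.exists_smul_eq_self (M := S)
      obtain ⟨φ⟩ := h.exists_topMod_equiv hx h0
      exact ⟨i, Quotient.sound ⟨φ.symm⟩⟩

theorem simEquiv_eq_cls_iff (i : ι) (S : SimpleMod A) :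
    h.simEquiv i = S.cls ↔ Nonempty (S.1 ≃ₗ[A] topMod (e i)) := by
  constructor
  · intro hS
    obtain ⟨φ⟩ := Quotient.exact hS
    exact ⟨φ.symm⟩
  · rintro ⟨φ⟩
    exact Quotient.sound ⟨φ.symm⟩

theorem exists_generator_of_equiv {M : Type*} [AddCommGroup M] [Module A M] {i : ι}
    (φ : M ≃ₗ[A] topMod (e i)) : ∃ x : M, e i • x = x ∧ x ≠ 0 := by
  obtain ⟨x, hx, h0⟩ := h.topMod_generator i
  exact ⟨φ.symm x, by rw [← map_smul, hx], by rwa [Ne, LinearEquiv.map_eq_zero_iff]⟩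

open CategoryTheory in
open scoped ModuleCat in
-- Let `K` be the kernel of `Ae_i → L`. As `Ae_i` is projective, `Ext¹(L, L')` is a quotient of
-- `Hom(K, L')`. Since `K` lies in `J`, the vanishing of `e_j J e_i` would give `e_j K = 0`, hence
-- no nonzero map `K → L'`.
theorem exists_mul_ne_zero_of_ext {i j : ι} (L L' : SimpleMod A)
    (hL : L.1 ≃ₗ[A] topMod (e i)) (hL' : L'.1 ≃ₗ[A] topMod (e j))
    (hE : Nontrivial (Abelian.Ext L.1 L'.1 1)) : ∃ a ∈ J, e j * a * e i ≠ 0 := by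
  by_contra! hc
  have := L.2
  have := L'.2
  obtain ⟨x, hx, h0⟩ := h.exists_generator_of_equiv hL
  obtain ⟨y, hy, h1⟩ := h.exists_generator_of_equiv hL'
  have hproj : Module.Projective A (projMod (e i)) := by
    refine Module.Projective.of_split (projMod (e i)).subtype
      (LinearMap.toSpanSingleton A _ ⟨e i, self_mem_projMod _⟩) ?_
    ext z
    exact h.mul_eq_of_mem_projMod z.2
  let π := projMap (e i) x
  have hS : π.shortComplexKer.ShortExact := π.shortExact_shortComplexKer (projMap_surjective hx h0)
  have hP : Projective π.shortComplexKer.X₂ :=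
    ModuleCat.projective_of_categoryTheory_projective (P := ModuleCat.of A (projMod (e i)))
  have hlin : ∀ f : LinearMap.ker π →ₗ[A] L'.1, f = 0 := by
    intro f
    ext z
    have hz : (z : A) ∈ J := h.ker_projMap_le hx h0 z.2
    have hj : e j • z = 0 := by
      refine Subtype.ext (Subtype.ext ?_)
      have := hc z hz
      rwa [mul_assoc, h.mul_eq_of_mem_projMod z.1.2] at this
    rw [LinearMap.zero_apply, ← one_smul A (f z), ← h.idem.complete, Finset.sum_smul]
    refine Finset.sum_eq_zero fun l _ => ?_
    by_cases hl : l = j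
    · rw [hl, ← map_smul, hj, map_zero]
    · exact h.smul_eq_zero_of_ne hl hy h1 _
  have hzero : ∀ f : π.shortComplexKer.X₁ ⟶ L'.1, f = 0 := fun f =>
    ModuleCat.hom_ext (hlin f.hom)
  have : ∀ ε : Abelian.Ext L.1 L'.1 1, ε = 0 := by
    intro ε
    obtain ⟨x₁, rfl⟩ := Abelian.Ext.contravariant_sequence_exact₃ hS L'.1 ε
      (Abelian.Ext.eq_zero_of_projective _) (n₀ := 0) rfl
    obtain ⟨f, rfl⟩ := Abelian.Ext.homEquiv₀.symm.surjective x₁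
    rw [hzero f]
    simp
  obtain ⟨ε, hε⟩ := exists_ne (0 : Abelian.Ext L.1 L'.1 1)
  exact hε (this ε)

end IsSplitBasic

end SplitBasic

/-! ### Dual bases and exactness of induction -/

section DualBasis

open TensorProduct

variable {k : Type w} [Field k] {A : Type u} [Ring A] [Algebra k A] {B : Subalgebra k A}

/-- A finite dual basis of `A` as a right `B`-module. -/
structure IsDualBasis {D : Type*} [Fintype D] (q : D → A) (c : D → A →+ B) : Prop where
  map_mul : ∀ d a (b : B), c d (a * b) = c d a * b
  sum_eq : ∀ a, ∑ d, q d * (c d a : A) = a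

namespace IsDualBasis

variable {D : Type*} [Fintype D] {q : D → A} {c : D → A →+ B}

/-- The map `a ⊗ m ↦ c_d(a) m`. -/
noncomputable def coord (c : D → A →+ B) (d : D) (M : Type v) [AddCommGroup M] [Module B M] :
    A ⊗[ℤ] M →ₗ[ℤ] M :=
  TensorProduct.lift ((LinearMap.mk₂ ℤ (fun (b : B) (m : M) => b • m) add_smul
    (fun n b m => smul_assoc n b m) smul_add (fun n b m => smul_comm b n m)) ∘ₗ
      (c d).toIntLinearMap)

omit [Fintype D] in
@[simp] theorem coord_tmul (d : D) {M : Type v} [AddCommGroup M] [Module B M] (a : A) (m : M) :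
    coord c d M (a ⊗ₜ m) = c d a • m := rfl

omit [Fintype D] in
theorem coord_map (d : D) {M N : Type v} [AddCommGroup M] [Module B M] [AddCommGroup N]
    [Module B N] (f : M →ₗ[B] N) (x : A ⊗[ℤ] M) :
    coord c d N (AlgebraTensorModule.map (LinearMap.id : A →ₗ[A] A)
      f.toAddMonoidHom.toIntLinearMap x) = f (coord c d M x) := by
  induction x with
  | zero => simp
  | tmul a m => simp
  | add x y hx hy => simp [hx, hy]

variable (h : IsDualBasis q c)

include h

theorem coord_eq_zero_of_mem (d : D) {M : Type v} [AddCommGroup M] [Module B M]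
    {x : A ⊗[ℤ] M} (hx : x ∈ inducedRel B M) : coord c d M x = 0 := by
  -- The relations form an `A`-submodule while the coordinate map is only additive, so the induction
  -- needs all multiples `a • x`.
  suffices H : ∀ a : A, coord c d M (a • x) = 0 by simpa using H 1
  induction hx using Submodule.span_induction with
  | mem x hx =>
    obtain ⟨a, b, m, rfl⟩ := hx
    intro a'
    rw [smul_sub, smul_tmul', smul_tmul', map_sub, coord_tmul, coord_tmul, smul_eq_mul,
      smul_eq_mul, ← mul_assoc, h.map_mul, mul_smul, sub_self]
  | zero => simp
  | add x y _ _ hx hy => intro a; rw [smul_add, map_add, hx, hy, add_zero]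
  | smul b x _ hx => intro a; rw [← mul_smul]; exact hx _

omit h in
theorem _root_.Induced.mk_mul_tmul {M : Type v} [AddCommGroup M] [Module B M] (a : A) (b : B)
    (m : M) : (inducedRel B M).mkQ ((a * (b : A)) ⊗ₜ m) = (inducedRel B M).mkQ (a ⊗ₜ (b • m)) := by
  rw [← sub_eq_zero, ← map_sub, Submodule.mkQ_apply, Submodule.Quotient.mk_eq_zero]
  exact Submodule.subset_span ⟨a, b, m, rfl⟩

theorem sum_coord {M : Type v} [AddCommGroup M] [Module B M] (x : A ⊗[ℤ] M) :
    (inducedRel B M).mkQ (∑ d, q d ⊗ₜ coord c d M x) = (inducedRel B M).mkQ x := by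
  induction x with
  | zero => simp
  | tmul a m =>
    simp only [coord_tmul, map_sum, ← Induced.mk_mul_tmul]
    rw [← map_sum, ← TensorProduct.sum_tmul, h.sum_eq]
  | add x y hx hy => simp only [map_add, tmul_add, Finset.sum_add_distrib, hx, hy]

theorem mkQ_eq_zero_iff {M : Type v} [AddCommGroup M] [Module B M] (x : A ⊗[ℤ] M) :
    (inducedRel B M).mkQ x = 0 ↔ ∀ d, coord c d M x = 0 := by
  constructor
  · intro hx d
    refine h.coord_eq_zero_of_mem d ?_
    rwa [Submodule.mkQ_apply, Submodule.Quotient.mk_eq_zero] at hx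
  · intro hx
    rw [← h.sum_coord]
    simp [hx]

/-- An element of `A ⊗_B M` vanishes exactly when its coordinates in `M` vanish, and coordinates
commute with induced maps. So exactness is checked coordinatewise, and preimages are assembled as `∑
q_d ⊗ y_d`. -/
theorem inductionExact : InductionExact B := by
  intro M₁ M₂ M₃ _ _ _ _ _ _ _ _ _ f g hf hfg hg
  refine ⟨?_, ?_, ?_⟩
  · rw [injective_iff_map_eq_zero]
    intro x hx
    obtain ⟨x, rfl⟩ := Submodule.mkQ_surjective _ x
    rw [h.mkQ_eq_zero_iff]
    intro d
    have := (h.mkQ_eq_zero_iff _).mp hx d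
    rw [coord_map] at this
    exact hf (this.trans (map_zero f).symm)
  · intro x
    obtain ⟨x, rfl⟩ := Submodule.mkQ_surjective _ x
    constructor
    · intro hx
      have hx := (h.mkQ_eq_zero_iff _).mp hx
      choose y hy using fun d => (hfg (coord c d M₂ x)).mp (by rw [← coord_map, hx d])
      refine ⟨(inducedRel B M₁).mkQ (∑ d, q d ⊗ₜ y d), ?_⟩
      rw [← h.sum_coord x]
      refine congrArg (inducedRel B M₂).mkQ ?_
      simp [hy]
    · rintro ⟨y, hy⟩
      rw [← hy]
      obtain ⟨y, rfl⟩ := Submodule.mkQ_surjective _ y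
      refine (h.mkQ_eq_zero_iff _).mpr fun d => ?_
      rw [coord_map, coord_map]
      exact hfg.apply_apply_eq_zero _
  · intro x
    obtain ⟨x, rfl⟩ := Submodule.mkQ_surjective _ x
    choose y hy using fun d => hg (coord c d M₃ x)
    refine ⟨(inducedRel B M₂).mkQ (∑ d, q d ⊗ₜ y d), ?_⟩
    rw [← h.sum_coord x]
    refine congrArg (inducedRel B M₃).mkQ ?_
    simp [hy]

end IsDualBasis

end DualBasis

/-! ### Monomial algebras: the basis of nonzero paths, and algebras spanned by paths -/

section PathSpan

open QPath

variable {k : Type u} [Field k] {V : Type v} [Quiver.{w} V]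

namespace PathAlgebra

theorem mul_mem_span {S T U : Set (QPath V)} [Fintype V]
    (hST : ∀ p ∈ S, ∀ q ∈ T, ∀ h, compOf p q h ∈ U) {x y : PathAlgebra k V}
    (hx : x ∈ Submodule.span k (ofPath k '' S)) (hy : y ∈ Submodule.span k (ofPath k '' T)) :
    x * y ∈ Submodule.span k (ofPath k '' U) := by
  induction hx using Submodule.span_induction with
  | mem x hx =>
    obtain ⟨p, hp, rfl⟩ := hx
    induction hy using Submodule.span_induction with
    | mem y hy =>
      obtain ⟨q, hq, rfl⟩ := hy
      rw [ofPath_mul_ofPath, pathMul]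
      split_ifs with h
      · exact Submodule.subset_span ⟨_, hST p hp q hq h, rfl⟩
      · exact zero_mem _
    | zero => rw [mul_zero]; exact zero_mem _
    | add y z _ _ hy hz => rw [mul_add]; exact add_mem hy hz
    | smul c y _ hy => rw [mul_smul_comm]; exact Submodule.smul_mem _ _ hy
  | zero => rw [zero_mul]; exact zero_mem _
  | add y z _ _ hy hz => rw [add_mul]; exact add_mem hy hz
  | smul c y _ hy => rw [smul_mul_assoc]; exact Submodule.smul_mem _ _ hy

theorem mem_span_univ (x : PathAlgebra k V) :
    x ∈ Submodule.span k (ofPath k '' (Set.univ : Set (QPath V))) := by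
  induction x using induction_on with
  | zero => exact zero_mem _
  | add x y hx hy => exact add_mem hx hy
  | smul c p => exact Submodule.smul_mem _ _ (Submodule.subset_span ⟨p, trivial, rfl⟩)

variable (k) in
/-- The coefficient of a path. -/
noncomputable def coeff (p : QPath V) : PathAlgebra k V →ₗ[k] k := Finsupp.lapply p

theorem coeff_ofPath_self (p : QPath V) : coeff k p (ofPath k p) = 1 :=
  Finsupp.single_eq_same

theorem coeff_ofPath_of_ne {p q : QPath V} (h : p ≠ q) : coeff k p (ofPath k q) = 0 :=
  Finsupp.single_eq_of_ne h

theorem coeff_eq_zero_of_mem_span {S : Set (QPath V)} {p : QPath V} (hp : p ∉ S)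
    {x : PathAlgebra k V} (hx : x ∈ Submodule.span k (ofPath k '' S)) : coeff k p x = 0 := by
  induction hx using Submodule.span_induction with
  | mem x hx =>
    obtain ⟨q, hq, rfl⟩ := hx
    exact coeff_ofPath_of_ne fun h => hp (h ▸ hq)
  | zero => exact map_zero _
  | add x y _ _ hx hy => rw [map_add, hx, hy, add_zero]
  | smul c x _ hx => rw [map_smul, hx, smul_zero]

end PathAlgebra

open PathAlgebra

variable [Fintype V]

/-- The span of a set of paths that is stable under extension on both sides is an ideal. It is
applied to the paths that vanish in `A`, which yields the basis of nonzero paths, and to the paths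
of length at least two. -/
theorem mem_span_of_mem_monomialIdeal {R Z : Set (QPath V)}
    (hl : ∀ q r h, r ∈ Z → compOf q r h ∈ Z) (hr : ∀ q r h, q ∈ Z → compOf q r h ∈ Z)
    (hR : R ⊆ Z) {x : PathAlgebra k V} (hx : x ∈ monomialIdeal k R) :
    x ∈ Submodule.span k (ofPath k '' Z) := by
  induction hx using TwoSidedIdeal.span_induction with
  | mem x hx =>
    obtain ⟨p, hp, rfl⟩ := hx
    exact Submodule.subset_span ⟨p, hR hp, rfl⟩
  | zero => exact zero_mem _
  | add x y _ _ hx hy => exact add_mem hx hy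
  | neg x _ hx => exact neg_mem hx
  | left_absorb a x _ hx =>
    exact mul_mem_span (fun p _ q hq h => hl p q h hq) (mem_span_univ a) hx
  | right_absorb b x _ hx =>
    exact mul_mem_span (fun p hp q _ h => hr p q h hp) hx (mem_span_univ b)

variable {R : Set (QPath V)}

theorem pathClass_eq_zero_iff (p : QPath V) :
    pathClass k R p = 0 ↔ ofPath k p ∈ monomialIdeal k R := by
  rw [TwoSidedIdeal.mem_iff, ← RingCon.eq]
  rfl

theorem pathClass_mul (p q : QPath V) (h : q.tgt = p.src) :
    pathClass k R p * pathClass k R q = pathClass k R (compOf p q h) := by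
  have : (ofPath k p * ofPath k q : PathAlgebra k V) = ofPath k (compOf p q h) := by
    rw [ofPath_mul_ofPath, pathMul, dif_pos h]
  rw [pathClass, pathClass, pathClass, ← this]
  rfl

theorem pathClass_mul_of_ne {p q : QPath V} (h : q.tgt ≠ p.src) :
    pathClass k R p * pathClass k R q = 0 := by
  have : (ofPath k p * ofPath k q : PathAlgebra k V) = 0 := by
    rw [ofPath_mul_ofPath, pathMul, dif_neg h]
  rw [pathClass, pathClass, ← RingCon.coe_mul, this]
  rfl

variable (k R) in
/-- The path is nonzero in the monomial algebra. -/
def IsGood (p : QPath V) : Prop := pathClass k R p ≠ 0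

theorem IsGood.of_compOf_left {p q : QPath V} {h : q.tgt = p.src}
    (H : IsGood k R (compOf p q h)) : IsGood k R p := fun h0 => H (by
  rw [← pathClass_mul, h0, zero_mul])

theorem IsGood.of_compOf_right {p q : QPath V} {h : q.tgt = p.src}
    (H : IsGood k R (compOf p q h)) : IsGood k R q := fun h0 => H (by
  rw [← pathClass_mul, h0, mul_zero])

theorem coeff_eq_zero_of_mem_monomialIdeal {p : QPath V} (hp : IsGood k R p)
    {x : PathAlgebra k V} (hx : x ∈ monomialIdeal k R) : PathAlgebra.coeff k p x = 0 := by
  refine coeff_eq_zero_of_mem_span (S := {q | ¬ IsGood k R q}) (by simpa using hp)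
    (mem_span_of_mem_monomialIdeal (R := R) ?_ ?_ ?_ hx)
  · exact fun q r h hr H => hr H.of_compOf_right
  · exact fun q r h hq H => hq H.of_compOf_left
  · intro q hq H
    exact H ((pathClass_eq_zero_iff q).mpr (TwoSidedIdeal.subset_span ⟨q, hq, rfl⟩))

theorem isGood_triv (hR : ∀ p ∈ R, 2 ≤ p.length) (a : V) : IsGood k R (triv a) := by
  intro h0
  have h1 := mem_span_of_mem_monomialIdeal (R := R) (Z := {p | 2 ≤ p.length}) ?_ ?_ hR
    ((pathClass_eq_zero_iff (k := k) (triv a)).mp h0)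
  · have := coeff_eq_zero_of_mem_span (p := triv a) (by simp) h1
    rw [coeff_ofPath_self] at this
    exact one_ne_zero this
  · intro q r h hr
    simp only [Set.mem_ofPred_eq, length_compOf] at *
    omega
  · intro q r h hr
    simp only [Set.mem_ofPred_eq, length_compOf] at *
    omega

variable (k R) in
/-- The span of a set of paths. -/
noncomputable def pathSpan (S : Set (QPath V)) : Submodule k (MonomialAlgebra k R) :=
  Submodule.span k (pathClass k R '' S)

theorem pathClass_mem_pathSpan {S : Set (QPath V)} {p : QPath V} (hp : p ∈ S) :
    pathClass k R p ∈ pathSpan k R S := Submodule.subset_span ⟨p, hp, rfl⟩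

theorem pathSpan_le {S : Set (QPath V)} {N : Submodule k (MonomialAlgebra k R)} :
    pathSpan k R S ≤ N ↔ ∀ p ∈ S, pathClass k R p ∈ N := by
  rw [pathSpan, Submodule.span_le, Set.image_subset_iff]
  rfl

theorem pathSpan_mono {S T : Set (QPath V)} (h : S ⊆ T) : pathSpan k R S ≤ pathSpan k R T :=
  Submodule.span_mono (Set.image_mono h)

theorem pathSpan_univ : pathSpan k R Set.univ = ⊤ := by
  rw [eq_top_iff]
  rintro x -
  obtain ⟨x, rfl⟩ := RingCon.mkₐ_surjective (α := k) _ x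
  induction x using PathAlgebra.induction_on with
  | zero => rw [map_zero]; exact zero_mem _
  | add x y hx hy => rw [map_add]; exact add_mem hx hy
  | smul c p =>
    rw [map_smul]
    exact Submodule.smul_mem _ _ (pathClass_mem_pathSpan (Set.mem_univ p))

theorem mul_mem_pathSpan {S T U : Set (QPath V)}
    (hST : ∀ p ∈ S, ∀ q ∈ T, ∀ h, compOf p q h ∈ U) {x y : MonomialAlgebra k R}
    (hx : x ∈ pathSpan k R S) (hy : y ∈ pathSpan k R T) : x * y ∈ pathSpan k R U := by
  have hle : pathSpan k R S * pathSpan k R T ≤ pathSpan k R U := by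
    rw [pathSpan, pathSpan, Submodule.span_mul_span, Submodule.span_le]
    rintro _ ⟨_, ⟨p, hp, rfl⟩, _, ⟨q, hq, rfl⟩, rfl⟩
    by_cases h : q.tgt = p.src
    · change pathClass k R p * pathClass k R q ∈ _
      rw [pathClass_mul p q h]
      exact pathClass_mem_pathSpan (hST p hp q hq h)
    · change pathClass k R p * pathClass k R q ∈ _
      rw [pathClass_mul_of_ne h]
      exact zero_mem _
  exact hle (Submodule.mul_mem_mul hx hy)

/-- The nonzero paths form a basis of the monomial algebra. -/
theorem linearIndependent_pathClass :
    LinearIndependent k fun p : {p // IsGood k R p} => pathClass k R p.1 := by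
  classical
  rw [linearIndependent_iff']
  intro s c hc p hp
  have h1 : ∑ q ∈ s, c q • ofPath k q.1 ∈ monomialIdeal k R := by
    rw [TwoSidedIdeal.mem_iff, ← RingCon.eq]
    have : (RingCon.mkₐ k (monomialIdeal k R).ringCon) (∑ q ∈ s, c q • ofPath k q.1) = 0 := by
      rw [map_sum]
      simp only [map_smul]
      exact hc
    exact this
  have h2 := coeff_eq_zero_of_mem_monomialIdeal p.2 h1
  rw [map_sum, Finset.sum_eq_single p] at h2
  · rwa [map_smul, coeff_ofPath_self, smul_eq_mul, mul_one] at h2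
  · intro q _ hq
    rw [map_smul, coeff_ofPath_of_ne (fun h => hq (Subtype.ext h.symm)), smul_zero]
  · exact fun h => absurd hp h

theorem pathSpan_eq_span_good (S : Set (QPath V)) :
    pathSpan k R S =
      Submodule.span k ((fun p : {p // IsGood k R p} => pathClass k R p.1) '' {p | p.1 ∈ S}) := by
  apply le_antisymm
  · rw [pathSpan_le]
    intro p hp
    by_cases hg : IsGood k R p
    · exact Submodule.subset_span ⟨⟨p, hg⟩, hp, rfl⟩
    · rw [not_not.mp hg]
      exact zero_mem _
  · refine Submodule.span_mono ?_
    rintro _ ⟨p, hp, rfl⟩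
    exact ⟨p.1, hp, rfl⟩

theorem pathClass_mem_pathSpan_iff {S : Set (QPath V)} {p : QPath V} (hp : IsGood k R p) :
    pathClass k R p ∈ pathSpan k R S ↔ p ∈ S := by
  refine ⟨fun h => ?_, pathClass_mem_pathSpan⟩
  rw [pathSpan_eq_span_good] at h
  by_contra hS
  exact linearIndependent_pathClass.notMem_span_image (x := ⟨p, hp⟩) hS h

variable (k R) in
/-- The basis of the monomial algebra consisting of the nonzero paths. -/
noncomputable def pathBasis : Module.Basis {p // IsGood k R p} k (MonomialAlgebra k R) :=
  Module.Basis.mk linearIndependent_pathClass (by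
    rw [← pathSpan_univ, pathSpan_eq_span_good]
    exact Submodule.span_mono (Set.image_subset_range _ _))

@[simp] theorem pathBasis_apply (p : {p // IsGood k R p}) :
    pathBasis k R p = pathClass k R p.1 := by
  simp [pathBasis]

theorem finite_good [FiniteDimensional k (MonomialAlgebra k R)] : Finite {p // IsGood k R p} :=
  Module.Finite.finite_basis (pathBasis k R)

theorem exists_length_lt [FiniteDimensional k (MonomialAlgebra k R)] :
    ∃ N, ∀ p : QPath V, IsGood k R p → p.length < N := by
  have := finite_good (k := k) (R := R)
  obtain ⟨N, hN⟩ := (Set.finite_range fun p : {p // IsGood k R p} => p.1.length).bddAbove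
  exact ⟨N + 1, fun p hp => Nat.lt_succ_of_le (hN ⟨⟨p, hp⟩, rfl⟩)⟩

theorem isNilpotent_of_mem_pathSpan [FiniteDimensional k (MonomialAlgebra k R)]
    {x : MonomialAlgebra k R} (hx : x ∈ pathSpan k R {p | 0 < p.length}) : IsNilpotent x := by
  obtain ⟨N, hN⟩ := exists_length_lt (k := k) (R := R)
  have hpow : ∀ m : ℕ, x ^ m ∈ pathSpan k R {p | m ≤ p.length} := by
    intro m
    induction m with
    | zero => simp [pathSpan_univ]
    | succ m ih =>
      rw [pow_succ]
      refine mul_mem_pathSpan ?_ ih hx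
      intro p hp q hq h
      simp only [Set.mem_ofPred_eq, length_compOf] at *
      omega
  refine ⟨N, ?_⟩
  have hbot : pathSpan k R {p | N ≤ p.length} ≤ ⊥ := by
    rw [pathSpan_le]
    intro p hp
    by_contra hg
    exact absurd (hN p hg) (not_lt.mpr hp)
  exact (Submodule.mem_bot k).mp (hbot (hpow N))

variable {n : ℕ} (num : V ≃ Fin n)

theorem vertexIdem_num (a : V) : vertexIdem k R num (num a) = pathClass k R (triv a) := by
  rw [vertexIdem, Equiv.symm_apply_apply]

theorem vertexIdem_mul_pathClass (p : QPath V) :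
    vertexIdem k R num (num p.tgt) * pathClass k R p = pathClass k R p := by
  rw [vertexIdem_num, pathClass_mul _ _ rfl, triv_compOf]

theorem pathClass_mul_vertexIdem (p : QPath V) :
    pathClass k R p * vertexIdem k R num (num p.src) = pathClass k R p := by
  rw [vertexIdem_num, pathClass_mul p (triv p.src) rfl]
  exact congrArg _ (compOf_triv p _ rfl)

theorem vertexIdem_mul_pathClass_of_ne {p : QPath V} {i : Fin n} (h : num p.tgt ≠ i) :
    vertexIdem k R num i * pathClass k R p = 0 :=
  pathClass_mul_of_ne fun h' => h (by rw [h']; simp)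

theorem pathClass_mul_vertexIdem_of_ne {p : QPath V} {i : Fin n} (h : num p.src ≠ i) :
    pathClass k R p * vertexIdem k R num i = 0 :=
  pathClass_mul_of_ne fun h' => h (by rw [← h']; simp)

theorem completeOrthogonalIdempotents_vertexIdem :
    CompleteOrthogonalIdempotents (vertexIdem k R num) := by
  refine ⟨⟨fun i => ?_, fun i j hij => ?_⟩, ?_⟩
  · have := vertexIdem_mul_pathClass (k := k) (R := R) num (triv (num.symm i))
    rwa [triv_tgt, Equiv.apply_symm_apply] at this
  · exact vertexIdem_mul_pathClass_of_ne num (by simpa using hij.symm)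
  · rw [← num.sum_comp]
    simp only [vertexIdem_num]
    have : (RingCon.mkₐ k (monomialIdeal k R).ringCon) (∑ a : V, ofPath k (triv a)) = 1 := by
      rw [← one_def, map_one]
    rw [map_sum] at this
    exact this

theorem vertexIdem_mem_pathSpan {T : Set (QPath V)} (hT : ∀ a, triv a ∈ T) (i : Fin n) :
    vertexIdem k R num i ∈ pathSpan k R T := pathClass_mem_pathSpan (hT _)

variable (k R) in
/-- The subalgebra spanned by a set of paths that contains the trivial paths and that is closed
under composition. -/
noncomputable def pathSubalgebra (T : Set (QPath V)) (hT : ∀ a, triv a ∈ T)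
    (hT' : ∀ p ∈ T, ∀ q ∈ T, ∀ h, compOf p q h ∈ T) : Subalgebra k (MonomialAlgebra k R) :=
  (pathSpan k R T).toSubalgebra
    (by
      -- Any numbering of the vertices serves to write `1` as the sum of the trivial paths.
      have := completeOrthogonalIdempotents_vertexIdem (k := k) (R := R) (Fintype.equivFin V)
      rw [← this.complete]
      exact sum_mem fun i _ => vertexIdem_mem_pathSpan _ hT i)
    fun _ _ hx hy => mul_mem_pathSpan hT' hx hy

section Embedding

variable {C : Type*} [Ring C] [Algebra k C] (f : C →ₐ[k] MonomialAlgebra k R)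
  {T : Set (QPath V)}
  (hT' : ∀ p ∈ T, ∀ q ∈ T, ∀ h, compOf p q h ∈ T)
  (hf : LinearMap.range f.toLinearMap = pathSpan k R T)

include hf in
theorem map_mem_pathSpan (x : C) : f x ∈ pathSpan k R T := by
  rw [← hf]; exact ⟨x, rfl⟩

/-- The left ideal spanned by the nontrivial paths, in an algebra that is spanned by paths. -/
def pathRadical : Ideal C where
  carrier := {x | f x ∈ pathSpan k R (T ∩ {p | 0 < p.length})}
  add_mem' hx hy := by
    rw [Set.mem_ofPred_eq, map_add]; exact add_mem hx hy
  zero_mem' := by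
    rw [Set.mem_ofPred_eq, map_zero]; exact zero_mem _
  smul_mem' c x hx := by
    rw [Set.mem_ofPred_eq, smul_eq_mul, map_mul]
    refine mul_mem_pathSpan ?_ (map_mem_pathSpan f hf c) hx
    intro p hp q hq h
    refine ⟨hT' p hp q hq.1 h, ?_⟩
    have := hq.2
    simp only [Set.mem_ofPred_eq, length_compOf] at *
    omega

theorem mem_pathRadical {x : C} :
    x ∈ pathRadical f hT' hf ↔ f x ∈ pathSpan k R (T ∩ {p | 0 < p.length}) := Iff.rfl

/-- Stated for an embedded algebra `C`, so that one proof serves `A`, `B_max` and `B_min`.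
Nilpotence comes from the bound on the lengths of nonzero paths. -/
theorem isSplitBasic_of_paths [FiniteDimensional k (MonomialAlgebra k R)]
    (hR : ∀ p ∈ R, 2 ≤ p.length) (hinj : Function.Injective f) {e : Fin n → C}
    (he : ∀ i, f (e i) = vertexIdem k R num i) :
    IsSplitBasic k e (pathRadical f hT' hf) where
  idem := by
    have H := completeOrthogonalIdempotents_vertexIdem (k := k) (R := R) num
    refine ⟨⟨fun i => hinj ?_, fun i j hij => hinj ?_⟩, hinj ?_⟩
    · rw [map_mul, he]; exact H.idem i
    · rw [map_mul, he, he, map_zero]; exact H.ortho hij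
    · rw [map_sum, map_one]; simpa only [he] using H.complete
  ne_zero i h0 := by
    have := he i
    rw [h0, map_zero] at this
    exact isGood_triv hR _ this.symm
  mul_mem x hx a := by
    rw [mem_pathRadical, map_mul]
    refine mul_mem_pathSpan ?_ hx (map_mem_pathSpan f hf a)
    intro p hp q hq h
    refine ⟨hT' p hp.1 q hq h, ?_⟩
    have := hp.2
    simp only [Set.mem_ofPred_eq, length_compOf] at *
    omega
  nil x hx := by
    obtain ⟨m, hm⟩ := isNilpotent_of_mem_pathSpan (pathSpan_mono Set.inter_subset_right hx)
    exact ⟨m, hinj (by rw [map_pow, hm, map_zero])⟩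
  exists_sub_mem a := by
    have key : ∀ x ∈ pathSpan k R T, ∃ c : Fin n → k, x - ∑ i, c i • vertexIdem k R num i ∈
        pathSpan k R (T ∩ {p | 0 < p.length}) := by
      intro x hx
      induction hx using Submodule.span_induction with
      | mem x hx =>
        obtain ⟨p, hp, rfl⟩ := hx
        rcases Nat.eq_zero_or_pos p.length with h0 | h0
        · refine ⟨Pi.single (num p.src) 1, ?_⟩
          rw [Finset.sum_eq_single (num p.src)]
          · rw [Pi.single_eq_same, one_smul, vertexIdem_num, ← eq_triv_of_length_eq_zero p h0,
              sub_self]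
            exact zero_mem _
          · intro i _ hi
            rw [Pi.single_eq_of_ne hi, zero_smul]
          · simp
        · refine ⟨0, ?_⟩
          simpa using pathClass_mem_pathSpan (S := T ∩ {p | 0 < p.length}) ⟨hp, h0⟩
      | zero => exact ⟨0, by simp⟩
      | add x y _ _ hx hy =>
        obtain ⟨c, hc⟩ := hx
        obtain ⟨d, hd⟩ := hy
        refine ⟨c + d, ?_⟩
        have := add_mem hc hd
        rw [← add_sub_add_comm, ← Finset.sum_add_distrib] at this
        simpa only [Pi.add_apply, add_smul] using this
      | smul c x _ hx =>
        obtain ⟨d, hd⟩ := hx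
        refine ⟨c • d, ?_⟩
        have := Submodule.smul_mem _ c hd
        rw [smul_sub, Finset.smul_sum] at this
        simpa only [Pi.smul_apply, smul_assoc] using this
    obtain ⟨c, hc⟩ := key _ (map_mem_pathSpan f hf a)
    refine ⟨c, ?_⟩
    rw [mem_pathRadical, map_sub, map_sum]
    simpa only [map_smul, he] using hc

end Embedding

end PathSpan

/-! ### The radicals of `A` and `B_max`, and the record paths as a basis of `B_min` -/

section Subalgebras

open QPath

variable {k : Type u} [Field k] {V : Type v} [Quiver.{w} V] [Fintype V] {R : Set (QPath V)}
  {n : ℕ} (num : V ≃ Fin n)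

theorem isDirectionPreserving_pathClass {p : QPath V} (h : num p.src < num p.tgt) :
    IsDirectionPreserving k R num (pathClass k R p) :=
  ⟨_, _, h, pathClass k R p, by rw [vertexIdem_mul_pathClass, pathClass_mul_vertexIdem]⟩

theorem IsDirectionPreserving.src_lt_tgt {p : QPath V} (hp : IsGood k R p)
    (h : IsDirectionPreserving k R num (pathClass k R p)) : num p.src < num p.tgt := by
  obtain ⟨i, j, hij, y, hy⟩ := h
  have H := completeOrthogonalIdempotents_vertexIdem (k := k) (R := R) num
  have h1 : vertexIdem k R num j * pathClass k R p = pathClass k R p := by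
    rw [hy, ← mul_assoc, ← mul_assoc, (H.idem j).eq]
  have h2 : pathClass k R p * vertexIdem k R num i = pathClass k R p := by
    rw [hy, mul_assoc, (H.idem i).eq]
  have h3 : num p.tgt = j := by
    by_contra h
    exact hp (by rw [← h1, vertexIdem_mul_pathClass_of_ne num h])
  have h4 : num p.src = i := by
    by_contra h
    exact hp (by rw [← h2, pathClass_mul_vertexIdem_of_ne num h])
  rwa [h3, h4]

/-- The trivial paths and the direction-preserving paths. -/
def ascendingPaths : Set (QPath V) := {p | p.length = 0 ∨ num p.src < num p.tgt}

omit [Fintype V] in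
theorem src_eq_tgt_of_length_eq_zero {p : QPath V} (h : p.length = 0) : p.src = p.tgt := by
  rw [eq_triv_of_length_eq_zero p h]; rfl

omit [Fintype V] in
theorem triv_mem_ascendingPaths (a : V) : triv a ∈ ascendingPaths num := Or.inl rfl

omit [Fintype V] in
theorem compOf_mem_ascendingPaths (p : QPath V) (hp : p ∈ ascendingPaths num) (q : QPath V)
    (hq : q ∈ ascendingPaths num) (h : q.tgt = p.src) : compOf p q h ∈ ascendingPaths num := by
  rcases hp with hp | hp
  · rcases hq with hq | hq
    · left; rw [length_compOf, hp, hq]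
    · right
      rwa [compOf_src, compOf_tgt, ← src_eq_tgt_of_length_eq_zero hp, ← h]
  · right
    rcases hq with hq | hq
    · rwa [compOf_src, compOf_tgt, src_eq_tgt_of_length_eq_zero hq, h]
    · rw [compOf_src, compOf_tgt]
      rw [h] at hq
      exact hq.trans hp

omit [Fintype V] in
theorem ascendingPaths_inter :
    ascendingPaths num ∩ {p | 0 < p.length} = {p | num p.src < num p.tgt} := by
  ext p
  constructor
  · rintro ⟨h | h, h'⟩
    · exact absurd h h'.ne'
    · exact h
  · intro h
    refine ⟨Or.inr h, Nat.pos_of_ne_zero fun h0 => ?_⟩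
    rw [Set.mem_ofPred_eq, src_eq_tgt_of_length_eq_zero h0] at h
    exact lt_irrefl _ h

theorem Bmax_eq : Bmax k R num = pathSubalgebra k R (ascendingPaths num)
    (triv_mem_ascendingPaths num) (compOf_mem_ascendingPaths num) := by
  apply le_antisymm
  · refine Algebra.adjoin_le ?_
    rintro x (⟨i, rfl⟩ | ⟨⟨h0, p, rfl⟩, h⟩)
    · exact vertexIdem_mem_pathSpan num (triv_mem_ascendingPaths num) i
    · exact pathClass_mem_pathSpan (Or.inr (h.src_lt_tgt num h0))
  · change pathSpan k R (ascendingPaths num) ≤ Subalgebra.toSubmodule (Bmax k R num)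
    rw [pathSpan_le]
    rintro p (hp | hp)
    · refine Algebra.subset_adjoin (Or.inl ⟨num p.src, ?_⟩)
      rw [vertexIdem_num, ← eq_triv_of_length_eq_zero p hp]
    · by_cases h0 : pathClass k R p = 0
      · rw [h0]; exact zero_mem _
      · exact Algebra.subset_adjoin (Or.inr ⟨⟨h0, p, rfl⟩, isDirectionPreserving_pathClass num hp⟩)

theorem range_val_Bmax :
    LinearMap.range (Bmax k R num).val.toLinearMap = pathSpan k R (ascendingPaths num) := by
  ext x
  have : x ∈ Bmax k R num ↔ x ∈ pathSpan k R (ascendingPaths num) := by rw [Bmax_eq]; rfl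
  rw [← this]
  simp

theorem vertexIdem_mem_Bmax (i : Fin n) : vertexIdem k R num i ∈ Bmax k R num :=
  Algebra.subset_adjoin (Or.inl ⟨i, rfl⟩)

theorem isSplitBasic_Bmax [FiniteDimensional k (MonomialAlgebra k R)]
    (hR : ∀ p ∈ R, 2 ≤ p.length) :
    IsSplitBasic k (fun i => (⟨vertexIdem k R num i, vertexIdem_mem_Bmax num i⟩ : Bmax k R num))
      (pathRadical (Bmax k R num).val (compOf_mem_ascendingPaths num) (range_val_Bmax num)) :=
  isSplitBasic_of_paths num _ _ _ hR Subtype.val_injective fun _ => rfl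

theorem range_id :
    LinearMap.range (AlgHom.id k (MonomialAlgebra k R)).toLinearMap = pathSpan k R Set.univ := by
  rw [pathSpan_univ]; exact LinearMap.range_id

variable (k R) in
/-- The ideal of the monomial algebra spanned by the nontrivial paths. -/
noncomputable def arrowIdeal : Ideal (MonomialAlgebra k R) :=
  pathRadical (AlgHom.id k (MonomialAlgebra k R)) (T := Set.univ) (fun _ _ _ _ _ => Set.mem_univ _)
    range_id

theorem mem_arrowIdeal {x : MonomialAlgebra k R} :
    x ∈ arrowIdeal k R ↔ x ∈ pathSpan k R {p | 0 < p.length} := by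
  rw [arrowIdeal, mem_pathRadical, Set.univ_inter]; rfl

theorem isSplitBasic_monomialAlgebra [FiniteDimensional k (MonomialAlgebra k R)]
    (hR : ∀ p ∈ R, 2 ≤ p.length) :
    IsSplitBasic k (vertexIdem k R num) (arrowIdeal k R) :=
  isSplitBasic_of_paths num _ _ _ hR Function.injective_id fun _ => rfl

theorem pathClass_mem_radProduct [FiniteDimensional k (MonomialAlgebra k R)]
    (hR : ∀ p ∈ R, 2 ≤ p.length) (q r : QPath V) (h : r.tgt = q.src) (hq : 0 < q.length)
    (hr : num r.src < num r.tgt) : pathClass k R (compOf q r h) ∈ radProduct k R num := by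
  rw [← pathClass_mul]
  refine Submodule.mul_mem_mul ?_ ?_
  · rw [Submodule.restrictScalars_mem, (isSplitBasic_monomialAlgebra num hR).ringJacobson_eq,
      mem_arrowIdeal]
    exact pathClass_mem_pathSpan hq
  · have hB : pathClass k R r ∈ Bmax k R num := by
      rw [Bmax_eq]
      exact pathClass_mem_pathSpan (Or.inr hr)
    refine ⟨⟨_, hB⟩, ?_, rfl⟩
    rw [(isSplitBasic_Bmax num hR).ringJacobson_eq, Submodule.coe_restrictScalars, SetLike.mem_coe,
      mem_pathRadical, ascendingPaths_inter]
    exact pathClass_mem_pathSpan hr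

/-- Both radicals are spanned by paths. With `pathClass_mem_radProduct`, a nonzero path lies in
`rad(A) rad(B_max)` exactly when some proper initial segment ends above its start. -/
theorem radProduct_le [FiniteDimensional k (MonomialAlgebra k R)]
    (hR : ∀ p ∈ R, 2 ≤ p.length) : radProduct k R num ≤ pathSpan k R
      {p | ∃ (q r : QPath V) (h : r.tgt = q.src), compOf q r h = p ∧ 0 < q.length ∧
        num r.src < num r.tgt} := by
  refine Submodule.mul_le.mpr ?_
  rintro x hx _ ⟨y, hy, rfl⟩
  rw [Submodule.restrictScalars_mem, (isSplitBasic_monomialAlgebra num hR).ringJacobson_eq,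
    mem_arrowIdeal] at hx
  rw [(isSplitBasic_Bmax num hR).ringJacobson_eq, Submodule.coe_restrictScalars, SetLike.mem_coe,
    mem_pathRadical, ascendingPaths_inter] at hy
  refine mul_mem_pathSpan ?_ hx hy
  intro p hp q hq h
  exact ⟨p, q, h, rfl, hp, hq⟩

/-- The paths whose target is larger than all earlier vertices. -/
def recordPaths : Set (QPath V) := {p | IsRecord num p}

omit [Fintype V] in
theorem triv_mem_recordPaths (a : V) : triv a ∈ recordPaths num := isRecord_triv a

omit [Fintype V] in
theorem compOf_mem_recordPaths (p : QPath V) (hp : p ∈ recordPaths num) (q : QPath V)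
    (hq : q ∈ recordPaths num) (h : q.tgt = p.src) : compOf p q h ∈ recordPaths num :=
  IsRecord.compOf hp hq h

/-- If the path is nontrivial, no proper initial segment `r` can end above its start, so `t(r) ≤
s(p) < t(p)`. -/
theorem isRecord_of_isRightMinimal [FiniteDimensional k (MonomialAlgebra k R)]
    (hR : ∀ p ∈ R, 2 ≤ p.length) {p : QPath V} (hp : IsGood k R p)
    (h : IsRightMinimal k R num (pathClass k R p)) : IsRecord num p := by
  obtain ⟨h1, h2⟩ := h
  have h3 : p ∈ ascendingPaths num := by
    rw [Bmax_eq] at h1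
    exact (pathClass_mem_pathSpan_iff hp).mp h1
  rcases h3 with h3 | h3
  · rw [eq_triv_of_length_eq_zero p h3]
    exact isRecord_triv _
  · rintro q r h rfl hq
    rw [compOf_src] at h3
    refine lt_of_le_of_lt ?_ h3
    by_contra hlt
    exact h2 (pathClass_mem_radProduct num hR q r h hq (not_le.mp hlt))

/-- A nonzero record path outside `rad(A) rad(B_max)` is a generator. Otherwise it is `qr` with `q`
nontrivial and `r` ending above its start; cutting `r` into a lower `a` after a record `r'` regroups
it as `(qa)r'`, a product of two shorter record paths. -/
theorem pathClass_mem_Bmin [FiniteDimensional k (MonomialAlgebra k R)]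
    (hR : ∀ p ∈ R, 2 ≤ p.length) {p : QPath V} (hg : IsGood k R p) (hp : IsRecord num p) :
    pathClass k R p ∈ Bmin k R num := by
  induction hl : p.length using Nat.strong_induction_on generalizing p with
  | _ m ih =>
  subst hl
  by_cases hfac : ∃ (q r : QPath V) (h : r.tgt = q.src), compOf q r h = p ∧ 0 < q.length ∧
      num r.src < num r.tgt
  · obtain ⟨q, r, h, rfl, hq, hr⟩ := hfac
    obtain ⟨a, r, h', rfl, ha, hr'⟩ := exists_lower_record num r
    -- Were the record part trivial, the segment being cut would be lower and could not end above
    -- its start. So both new factors are nontrivial, hence shorter.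
    have h1 : 0 < r.length := by
      refine Nat.pos_of_ne_zero fun h0 => ?_
      have h2 := ha (triv a.tgt) a rfl (triv_compOf _ _ rfl)
      rw [compOf_src, compOf_tgt, src_eq_tgt_of_length_eq_zero h0, h'] at hr
      exact hr.not_ge h2
    replace h : a.tgt = q.src := h
    rw [← compOf_assoc q a r h h'] at hg hp ih ⊢
    rw [← pathClass_mul (compOf q a h) r h']
    refine mul_mem (ih _ ?_ hg.of_compOf_left hp.of_compOf_left rfl)
      (ih _ ?_ hg.of_compOf_right hr' rfl)
    all_goals
      have h2 := length_compOf (compOf q a h) r h'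
      have h3 := length_compOf q a h
      omega
  · have hB : pathClass k R p ∈ Bmax k R num := by
      rw [Bmax_eq]
      refine pathClass_mem_pathSpan ?_
      rcases Nat.eq_zero_or_pos p.length with h0 | h0
      · exact Or.inl h0
      · exact Or.inr (hp.src_lt h0)
    refine Algebra.subset_adjoin ⟨⟨hg, p, rfl⟩, hB, fun h => hfac ?_⟩
    exact (pathClass_mem_pathSpan_iff hg).mp (radProduct_le num hR h)

theorem Bmin_eq [FiniteDimensional k (MonomialAlgebra k R)] (hR : ∀ p ∈ R, 2 ≤ p.length) :
    Bmin k R num = pathSubalgebra k R (recordPaths num)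
      (triv_mem_recordPaths num) (compOf_mem_recordPaths num) := by
  apply le_antisymm
  · refine Algebra.adjoin_le ?_
    rintro x ⟨⟨h0, p, rfl⟩, h⟩
    exact pathClass_mem_pathSpan (isRecord_of_isRightMinimal num hR h0 h)
  · change pathSpan k R (recordPaths num) ≤ Subalgebra.toSubmodule (Bmin k R num)
    rw [pathSpan_le]
    intro p hp
    by_cases h0 : pathClass k R p = 0
    · rw [h0]; exact zero_mem _
    · exact pathClass_mem_Bmin num hR h0 hp

theorem mem_Bmin_iff [FiniteDimensional k (MonomialAlgebra k R)] (hR : ∀ p ∈ R, 2 ≤ p.length)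
    {x : MonomialAlgebra k R} : x ∈ Bmin k R num ↔ x ∈ pathSpan k R (recordPaths num) := by
  rw [Bmin_eq num hR]; rfl

theorem range_val_Bmin [FiniteDimensional k (MonomialAlgebra k R)]
    (hR : ∀ p ∈ R, 2 ≤ p.length) :
    LinearMap.range (Bmin k R num).val.toLinearMap = pathSpan k R (recordPaths num) := by
  ext x
  rw [← mem_Bmin_iff num hR]
  simp

theorem vertexIdem_mem_Bmin [FiniteDimensional k (MonomialAlgebra k R)]
    (hR : ∀ p ∈ R, 2 ≤ p.length) (i : Fin n) : vertexIdem k R num i ∈ Bmin k R num := by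
  rw [mem_Bmin_iff num hR]
  exact vertexIdem_mem_pathSpan num (triv_mem_recordPaths num) i

theorem isSplitBasic_Bmin [FiniteDimensional k (MonomialAlgebra k R)]
    (hR : ∀ p ∈ R, 2 ≤ p.length) :
    IsSplitBasic k
      (fun i => (⟨vertexIdem k R num i, vertexIdem_mem_Bmin num hR i⟩ : Bmin k R num))
      (pathRadical (Bmin k R num).val (compOf_mem_recordPaths num) (range_val_Bmin num hR)) :=
  isSplitBasic_of_paths num _ _ _ hR Subtype.val_injective fun _ => rfl

theorem hasPathBasis_Bmin [FiniteDimensional k (MonomialAlgebra k R)]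
    (hR : ∀ p ∈ R, 2 ≤ p.length) : HasPathBasis k R (Bmin k R num) := by
  refine ⟨(fun p : {p // IsGood k R p} => pathClass k R p.1) '' {p | p.1 ∈ recordPaths num},
    ?_, ?_, ?_⟩
  · rintro _ ⟨p, _, rfl⟩
    exact ⟨p.2, p.1, rfl⟩
  · exact (linearIndependent_pathClass.linearIndepOn _).id_image
  · rw [← pathSpan_eq_span_good]
    ext x
    exact (mem_Bmin_iff num hR).symm

end Subalgebras

/-! ### Standard modules of a monomial algebra -/

section Standard

open QPath

variable {k : Type u} [Field k] {V : Type v} [Quiver.{w} V] [Fintype V] {R : Set (QPath V)}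
  {n : ℕ} (num : V ≃ Fin n)

variable (k R) in
/-- The ideal spanned by the paths through a vertex larger than `i`. -/
noncomputable def highIdeal (i : Fin n) : Ideal (MonomialAlgebra k R) where
  carrier := pathSpan k R {p | RisesAbove num i p}
  add_mem' := add_mem
  zero_mem' := zero_mem _
  smul_mem' a x hx := by
    have ha : a ∈ pathSpan k R Set.univ := by rw [pathSpan_univ]; trivial
    exact mul_mem_pathSpan (fun p _ q hq h => hq.compOf_left p h) ha hx

theorem mem_highIdeal {i : Fin n} {x : MonomialAlgebra k R} :
    x ∈ highIdeal k R num i ↔ x ∈ pathSpan k R {p | RisesAbove num i p} := Iff.rfl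

theorem mul_mem_highIdeal {i : Fin n} {x : MonomialAlgebra k R} (hx : x ∈ highIdeal k R num i)
    (a : MonomialAlgebra k R) : x * a ∈ highIdeal k R num i := by
  have ha : a ∈ pathSpan k R Set.univ := by rw [pathSpan_univ]; trivial
  exact mul_mem_pathSpan (fun p hp q _ h => RisesAbove.compOf_right hp q h) hx ha

theorem vertexIdem_mem_highIdeal {i j : Fin n} (hij : i < j) :
    vertexIdem k R num j ∈ highIdeal k R num i :=
  pathClass_mem_pathSpan (risesAbove_of_tgt (by simpa using hij))

/-- `L_j` is not a composition factor of `P_i / U` exactly when `U` contains `e_j A e_i`, and a path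
through `j` has the form `q e_j r`. -/
theorem standardKernel_eq [FiniteDimensional k (MonomialAlgebra k R)]
    (hR : ∀ p ∈ R, 2 ≤ p.length) (i : Fin n) :
    standardKernel (vertexIdem k R num) i =
      (highIdeal k R num i).submoduleOf (projMod (vertexIdem k R num i)) := by
  have hb := isSplitBasic_monomialAlgebra (k := k) num hR
  apply le_antisymm
  · refine sInf_le fun j hij => ?_
    rw [hb.isCompositionFactor_topMod_iff]
    push Not
    intro x
    obtain ⟨y, rfl⟩ := Submodule.Quotient.mk_surjective _ x
    rw [← Submodule.Quotient.mk_smul, Submodule.Quotient.mk_eq_zero]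
    exact mul_mem_highIdeal num (vertexIdem_mem_highIdeal num hij) _
  · refine le_sInf fun U hU => ?_
    have hU' : ∀ j, i < j → ∀ x : projMod (vertexIdem k R num i), vertexIdem k R num j • x ∈ U := by
      intro j hij x
      have := hU j hij
      rw [hb.isCompositionFactor_topMod_iff] at this
      push Not at this
      rw [← Submodule.Quotient.mk_eq_zero, Submodule.Quotient.mk_smul]
      exact this _
    have key : ∀ z ∈ pathSpan k R {p | RisesAbove num i p},
        z * vertexIdem k R num i ∈ U.map (projMod (vertexIdem k R num i)).subtype := by
      intro z hz
      induction hz using Submodule.span_induction with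
      | mem z hz =>
        obtain ⟨p, ⟨q, r, h, rfl, hr⟩, rfl⟩ := hz
        refine ⟨pathClass k R q • vertexIdem k R num (num r.tgt) •
          ⟨pathClass k R r * vertexIdem k R num i, IsSplitBasic.mem_projMod.mpr ⟨_, rfl⟩⟩,
          U.smul_mem _ (hU' _ hr _), ?_⟩
        change pathClass k R q * (vertexIdem k R num (num r.tgt) *
          (pathClass k R r * vertexIdem k R num i)) = _
        rw [← mul_assoc (vertexIdem k R num (num r.tgt)), vertexIdem_mul_pathClass, ← mul_assoc,
          pathClass_mul _ _ h]
      | zero => rw [zero_mul]; exact zero_mem _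
      | add x y _ _ hx hy => rw [add_mul]; exact add_mem hx hy
      | smul c x _ hx =>
        rw [smul_mul_assoc, Algebra.smul_def]
        exact Submodule.smul_mem _ _ hx
    intro x hx
    obtain ⟨y, hy, hxy⟩ := key x hx
    rw [hb.mul_eq_of_mem_projMod x.2] at hxy
    rwa [← Subtype.ext hxy]

theorem mk_eq_zero_standardMod_iff [FiniteDimensional k (MonomialAlgebra k R)]
    (hR : ∀ p ∈ R, 2 ≤ p.length) {i : Fin n} (x : projMod (vertexIdem k R num i)) :
    (Submodule.Quotient.mk x : standardMod (vertexIdem k R num) i) = 0 ↔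
      (x : MonomialAlgebra k R) ∈ highIdeal k R num i := by
  rw [Submodule.Quotient.mk_eq_zero, standardKernel_eq num hR]
  rfl

/-- In a quasi-hereditary monomial algebra, a nonzero cycle runs through a vertex that is larger
than its source. -/
theorem risesAbove_of_cycle [FiniteDimensional k (MonomialAlgebra k R)]
    (hR : ∀ p ∈ R, 2 ≤ p.length) (hqh : IsQuasiHereditary k (vertexIdem k R num)) {p : QPath V}
    (hp : IsGood k R p) (hl : 0 < p.length) (hc : p.src = p.tgt) :
    RisesAbove num (num p.src) p := by
  set i := num p.src with hi
  let x : projMod (vertexIdem k R num i) :=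
    ⟨pathClass k R p, IsSplitBasic.mem_projMod.mpr ⟨_, (pathClass_mul_vertexIdem num p).symm⟩⟩
  -- Right multiplication by the cycle is an endomorphism of `P_i`. It descends to `Δ_i` because the
  -- paths rising above `i` span a two-sided ideal, and there it must be a scalar.
  let f : projMod (vertexIdem k R num i) →ₗ[MonomialAlgebra k R] projMod (vertexIdem k R num i) :=
    IsSplitBasic.projMap (vertexIdem k R num i) x
  let F : Module.End (MonomialAlgebra k R) (standardMod (vertexIdem k R num) i) :=
    Submodule.mapQ _ _ f (by
      rw [standardKernel_eq num hR]
      intro y hy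
      exact mul_mem_highIdeal num hy _)
  obtain ⟨φ⟩ := hqh.2 i
  have hF : F = algebraMap k _ (φ F) := φ.injective (by simp)
  have h1 : F (Submodule.Quotient.mk ⟨_, IsSplitBasic.self_mem_projMod _⟩) =
      φ F • Submodule.Quotient.mk ⟨_, IsSplitBasic.self_mem_projMod _⟩ := by
    conv_lhs => rw [hF]
    rfl
  have h2 : (Submodule.Quotient.mk
      (vertexIdem k R num i • x - φ F • ⟨_, IsSplitBasic.self_mem_projMod _⟩) :
      standardMod (vertexIdem k R num) i) = 0 := by
    rw [Submodule.Quotient.mk_sub, sub_eq_zero]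
    exact h1
  rw [mk_eq_zero_standardMod_iff num hR] at h2
  replace h2 : vertexIdem k R num i * pathClass k R p - φ F • vertexIdem k R num i ∈
    pathSpan k R {p | RisesAbove num i p} := h2
  have h4 : vertexIdem k R num i * pathClass k R p = pathClass k R p := by
    rw [hi, hc, vertexIdem_mul_pathClass]
  rw [h4] at h2
  -- A nonzero path in the span of a set of paths belongs to the set, and `p` is not trivial.
  have h3 : pathClass k R p ∈ pathSpan k R ({p | RisesAbove num i p} ∪ {p | p.length = 0}) := by
    rw [← sub_add_cancel (pathClass k R p) (φ F • vertexIdem k R num i)]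
    refine add_mem (pathSpan_mono Set.subset_union_left h2) (Submodule.smul_mem _ _ ?_)
    exact vertexIdem_mem_pathSpan num (fun a => Or.inr rfl) _
  rcases (pathClass_mem_pathSpan_iff hp).mp h3 with h | h
  · exact h
  · exact absurd h hl.ne'

/-- Nonzero nontrivial cycles at `j` rise above `j`, so only `e_j` survives in the corner `e_j A
e_j`. Through this the condition on `End(Δ_j)` enters the count. -/
theorem exists_corner_sub_mem [FiniteDimensional k (MonomialAlgebra k R)]
    (hR : ∀ p ∈ R, 2 ≤ p.length) (hqh : IsQuasiHereditary k (vertexIdem k R num)) (j : Fin n)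
    (a : MonomialAlgebra k R) : ∃ c : k,
      vertexIdem k R num j * a * vertexIdem k R num j - c • vertexIdem k R num j ∈
        highIdeal k R num j := by
  have ha : a ∈ pathSpan k R Set.univ := by rw [pathSpan_univ]; trivial
  induction ha using Submodule.span_induction with
  | mem a ha =>
    obtain ⟨p, -, rfl⟩ := ha
    by_cases h1 : num p.tgt = j
    · by_cases h2 : num p.src = j
      · have h3 : vertexIdem k R num j * pathClass k R p * vertexIdem k R num j =
            pathClass k R p := by
          conv_lhs => rw [← h1, vertexIdem_mul_pathClass, h1, ← h2, pathClass_mul_vertexIdem]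
        rw [h3]
        rcases Nat.eq_zero_or_pos p.length with h0 | h0
        · refine ⟨1, ?_⟩
          rw [one_smul, ← h2, vertexIdem_num, ← eq_triv_of_length_eq_zero p h0, sub_self]
          exact zero_mem _
        · refine ⟨0, ?_⟩
          rw [zero_smul, sub_zero]
          by_cases hg : IsGood k R p
          · refine pathClass_mem_pathSpan ?_
            rw [← h2]
            exact risesAbove_of_cycle num hR hqh hg h0 (num.injective (h2.trans h1.symm))
          · rw [not_not.mp hg]
            exact zero_mem _
      · refine ⟨0, ?_⟩
        rw [mul_assoc, pathClass_mul_vertexIdem_of_ne num h2, mul_zero, zero_smul, sub_zero]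
        exact zero_mem _
    · refine ⟨0, ?_⟩
      rw [vertexIdem_mul_pathClass_of_ne num h1, zero_mul, zero_smul, sub_zero]
      exact zero_mem _
  | zero => exact ⟨0, by simp⟩
  | add x y _ _ hx hy =>
    obtain ⟨c, hc⟩ := hx
    obtain ⟨d, hd⟩ := hy
    refine ⟨c + d, ?_⟩
    rw [mul_add, add_mul, add_smul, add_sub_add_comm]
    exact add_mem hc hd
  | smul c x _ hx =>
    obtain ⟨d, hd⟩ := hx
    refine ⟨c * d, ?_⟩
    rw [mul_smul_comm, smul_mul_assoc, mul_smul, ← smul_sub]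
    exact Submodule.smul_mem (pathSpan k R _) c hd

/-- A generator of a standard subquotient. -/
theorem exists_generator_of_standard [FiniteDimensional k (MonomialAlgebra k R)]
    (hR : ∀ p ∈ R, 2 ≤ p.length) {i : Fin n} {N' N : Submodule (MonomialAlgebra k R)
      (MonomialAlgebra k R)}
    (θ : (N ⧸ N'.submoduleOf N) ≃ₗ[MonomialAlgebra k R] standardMod (vertexIdem k R num) i) :
    ∃ g ∈ N, vertexIdem k R num i * g = g ∧
      (∀ a, a * g ∈ N' ↔ a * vertexIdem k R num i ∈ highIdeal k R num i) ∧
      ∀ x ∈ N, ∃ a, x - a * g ∈ N' := by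
  have H := completeOrthogonalIdempotents_vertexIdem (k := k) (R := R) num
  set e := vertexIdem k R num i with he
  let u : standardMod (vertexIdem k R num) i :=
    Submodule.Quotient.mk ⟨e, IsSplitBasic.self_mem_projMod _⟩
  obtain ⟨g, hg⟩ := Submodule.Quotient.mk_surjective _ (θ.symm u)
  have hu : e • u = u := by
    refine congrArg Submodule.Quotient.mk (Subtype.ext ?_)
    exact H.idem i
  have hag : ∀ a : MonomialAlgebra k R,
      θ (Submodule.Quotient.mk (a • e • g)) = a • u := by
    intro a
    rw [Submodule.Quotient.mk_smul, Submodule.Quotient.mk_smul, hg, map_smul, map_smul,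
      θ.apply_symm_apply, hu]
  -- Multiplying the lift by `e_i` keeps its class, since `e_i` fixes the generator of `Δ_i`, and
  -- makes the lift itself fixed by `e_i`.
  refine ⟨e * g, (e • g).2, ?_, ?_, ?_⟩
  · rw [← mul_assoc, (H.idem i).eq]
  · intro a
    have h1 : a * (e * (g : MonomialAlgebra k R)) ∈ N' ↔
        (Submodule.Quotient.mk (a • e • g) : N ⧸ N'.submoduleOf N) = 0 := by
      rw [Submodule.Quotient.mk_eq_zero]; rfl
    rw [h1, ← θ.map_eq_zero_iff, hag]
    exact mk_eq_zero_standardMod_iff num hR ⟨a * e, _⟩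
  · intro x hx
    obtain ⟨⟨_, hy⟩, hyx⟩ := Submodule.Quotient.mk_surjective _ (θ (Submodule.Quotient.mk ⟨x, hx⟩))
    obtain ⟨a, rfl⟩ := IsSplitBasic.mem_projMod.mp hy
    refine ⟨a, ?_⟩
    have h1 : θ (Submodule.Quotient.mk (⟨x, hx⟩ - a • e • g)) = 0 := by
      rw [Submodule.Quotient.mk_sub, map_sub, hag, ← hyx, sub_eq_zero]
      rfl
    rw [θ.map_eq_zero_iff, Submodule.Quotient.mk_eq_zero] at h1
    exact h1

theorem finrank_pathSpan [FiniteDimensional k (MonomialAlgebra k R)] (S : Set (QPath V)) :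
    Module.finrank k (pathSpan k R S) = Nat.card {p : {p // IsGood k R p} // p.1 ∈ S} := by
  have := finite_good (k := k) (R := R)
  have := Fintype.ofFinite {p : {p // IsGood k R p} // p.1 ∈ S}
  have hli := (linearIndependent_pathClass (k := k) (R := R)).comp
    (Subtype.val : {p : {p // IsGood k R p} // p.1 ∈ S} → _) Subtype.val_injective
  have hrange : Set.range (Subtype.val : {p : {p // IsGood k R p} // p.1 ∈ S} → _) =
      {p | p.1 ∈ S} := Subtype.range_coe
  rw [pathSpan_eq_span_good, Nat.card_eq_fintype_card, ← finrank_span_eq_card hli, Set.range_comp,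
    hrange]

theorem disjoint_pathSpan {S T : Set (QPath V)} (h : Disjoint S T) :
    Disjoint (pathSpan k R S) (pathSpan k R T) := by
  rw [pathSpan_eq_span_good, pathSpan_eq_span_good]
  refine linearIndependent_pathClass.disjoint_span_image ?_
  rw [Set.disjoint_left] at h ⊢
  exact fun p hp hq => h hp hq

end Standard

/-! ### Counting paths along a standard filtration -/

section Counting

open QPath

variable {k : Type u} [Field k] {V : Type v} [Quiver.{w} V] [Fintype V] {R : Set (QPath V)}
  {n : ℕ} (num : V ≃ Fin n)

variable (k R) in
/-- The nonzero paths that start in `j` and stay below `j`. -/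
abbrev LowerFrom (j : Fin n) : Type _ :=
  {p : {p // IsGood k R p} // p.1 ∈ {p | IsLower num p ∧ num p.src = j}}

variable (k R) in
/-- The nonzero paths that end in `j`, and for which all earlier vertices are smaller. -/
abbrev RecordTo (j : Fin n) : Type _ :=
  {p : {p // IsGood k R p} // p.1 ∈ {p | IsRecord num p ∧ num p.tgt = j}}

/-- If `g_l` are generators of the standard subquotients of a filtration, then `e_j F_m` lies in
the span of the `g_l` that belong to `j`, up to paths through larger vertices. -/
theorem vertexIdem_mul_mem_of_filtration [FiniteDimensional k (MonomialAlgebra k R)]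
    (hR : ∀ p ∈ R, 2 ≤ p.length) (hqh : IsQuasiHereditary k (vertexIdem k R num))
    {F : ℕ → Submodule (MonomialAlgebra k R) (MonomialAlgebra k R)} (h0 : F 0 = ⊥) {m : ℕ}
    {i : ℕ → Fin n} {g : ℕ → MonomialAlgebra k R}
    (hg : ∀ l < m, g l ∈ F (l + 1) ∧ vertexIdem k R num (i l) * g l = g l ∧
      (∀ a, a * g l ∈ F l ↔ a * vertexIdem k R num (i l) ∈ highIdeal k R num (i l)) ∧
      ∀ x ∈ F (l + 1), ∃ a, x - a * g l ∈ F l) (j : Fin n) :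
    ∀ l ≤ m, ∀ x ∈ F l, vertexIdem k R num j * x ∈
      Submodule.span k (g '' {l | l < m ∧ i l = j}) ⊔ pathSpan k R {p | RisesAbove num j p} := by
  have H := completeOrthogonalIdempotents_vertexIdem (k := k) (R := R) num
  intro l
  induction l with
  | zero =>
    intro _ x hx
    rw [h0, Submodule.mem_bot] at hx
    rw [hx, mul_zero]
    exact zero_mem _
  | succ l ih =>
    intro hl x hx
    obtain ⟨-, hg2, hg3, hg4⟩ := hg l hl
    replace ih := ih (by omega)
    obtain ⟨a, ha⟩ := hg4 x hx
    rw [← sub_add_cancel x (a * g l), mul_add]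
    refine add_mem (ih _ ha) ?_
    have hidem : ∀ y, vertexIdem k R num j * (vertexIdem k R num j * y) =
        vertexIdem k R num j * y := fun y => by rw [← mul_assoc, (H.idem j).eq]
    -- For `i_l < j`, the factor `Δ_{i_l}` is killed by `e_j`, so `e_j a g_l` drops into `F_l`. For
    -- `i_l = j`, the corner at `j` acts on `g_l` by scalars modulo `F_l`. For `i_l > j`, the
    -- element factors through a vertex above `j`, because `g_l = e_{i_l} g_l`.
    rcases lt_trichotomy (i l) j with hij | hij | hij
    · have h1 : vertexIdem k R num j * (a * g l) ∈ F l := by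
        rw [← mul_assoc, hg3, mul_assoc]
        exact mul_mem_highIdeal num (vertexIdem_mem_highIdeal num hij) _
      rw [← hidem]
      exact ih _ h1
    · obtain ⟨c, hc⟩ := exists_corner_sub_mem num hR hqh j a
      rw [hij] at hg2
      have h1 : (vertexIdem k R num j * a - algebraMap k _ c) * g l ∈ F l := by
        rw [hg3, hij, sub_mul, ← Algebra.smul_def]
        exact hc
      have h2 : vertexIdem k R num j * (a * g l) = vertexIdem k R num j *
          ((vertexIdem k R num j * a - algebraMap k _ c) * g l) + c • g l := by
        rw [sub_mul, mul_sub, mul_assoc, hidem, ← Algebra.smul_def, mul_smul_comm, hg2,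
          sub_add_cancel]
      rw [h2]
      refine add_mem (ih _ h1) (Submodule.mem_sup_left (Submodule.smul_mem _ _ ?_))
      exact Submodule.subset_span ⟨l, ⟨hl, hij⟩, rfl⟩
    · refine Submodule.mem_sup_right ?_
      rw [← hg2, ← mul_assoc, ← mul_assoc]
      exact mul_mem_highIdeal num
        ((highIdeal k R num j).mul_mem_left _ (vertexIdem_mem_highIdeal num hij)) _

/-- Record paths to `j` lie in `e_j A` and never rise above `j`, so they are independent modulo the
paths that do. The `g_l` belonging to `j` span at least as much. -/
theorem card_recordTo_le [FiniteDimensional k (MonomialAlgebra k R)]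
    {m : ℕ} {i : ℕ → Fin n} {g : ℕ → MonomialAlgebra k R} (j : Fin n)
    (h : ∀ x, vertexIdem k R num j * x ∈
      Submodule.span k (g '' {l | l < m ∧ i l = j}) ⊔ pathSpan k R {p | RisesAbove num j p}) :
    Nat.card (RecordTo k R num j) ≤ ((Finset.range m).filter (i · = j)).card := by
  classical
  have hdisj : Disjoint (pathSpan k R {p | IsRecord num p ∧ num p.tgt = j})
      (pathSpan k R {p | RisesAbove num j p}) := by
    refine disjoint_pathSpan (Set.disjoint_left.mpr ?_)
    rintro p ⟨hp, rfl⟩ ⟨q, r, h, e, hr⟩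
    exact absurd (hp.initial_le e) (not_le.mpr hr)
  have hle : pathSpan k R {p | IsRecord num p ∧ num p.tgt = j} ⊔
      pathSpan k R {p | RisesAbove num j p} ≤
      Submodule.span k (g '' {l | l < m ∧ i l = j}) ⊔ pathSpan k R {p | RisesAbove num j p} := by
    refine sup_le ?_ le_sup_right
    rw [pathSpan_le]
    rintro p ⟨-, rfl⟩
    rw [← vertexIdem_mul_pathClass num]
    exact h _
  have h1 := Submodule.finrank_mono hle
  have h2 := Submodule.finrank_sup_add_finrank_inf_eq
    (pathSpan k R {p | IsRecord num p ∧ num p.tgt = j}) (pathSpan k R {p | RisesAbove num j p})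
  rw [hdisj.eq_bot, finrank_bot, finrank_pathSpan] at h2
  have h3 := Submodule.finrank_add_le_finrank_add_finrank
    (Submodule.span k (g '' {l | l < m ∧ i l = j})) (pathSpan k R {p | RisesAbove num j p})
  have h4 : Module.finrank k (Submodule.span k (g '' {l | l < m ∧ i l = j})) ≤
      ((Finset.range m).filter (i · = j)).card := by
    have : g '' {l | l < m ∧ i l = j} = (((Finset.range m).filter (i · = j)).image g :
        Finset _) := by
      ext; simp
    rw [this]
    exact (finrank_span_finset_le_card _).trans Finset.card_image_le
  change Nat.card {p : {p // IsGood k R p} // p.1 ∈ {p | IsRecord num p ∧ num p.tgt = j}} ≤ _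
  omega

/-- Right multiplication by `g_l` sends the lower paths from `i_l` to elements of `F_{l+1}` that are
independent modulo `F_l`, since no lower path from `i_l` rises above `i_l`. -/
theorem sum_card_lowerFrom_le [FiniteDimensional k (MonomialAlgebra k R)]
    {F : ℕ → Submodule (MonomialAlgebra k R) (MonomialAlgebra k R)} {m : ℕ}
    {i : ℕ → Fin n} {g : ℕ → MonomialAlgebra k R} (hF : ∀ l < m, F l ≤ F (l + 1))
    (hg : ∀ l < m, g l ∈ F (l + 1) ∧ vertexIdem k R num (i l) * g l = g l ∧
      (∀ a, a * g l ∈ F l ↔ a * vertexIdem k R num (i l) ∈ highIdeal k R num (i l)) ∧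
      ∀ x ∈ F (l + 1), ∃ a, x - a * g l ∈ F l) :
    ∀ l ≤ m, ∑ t ∈ Finset.range l, Nat.card (LowerFrom k R num (i t)) ≤
      Module.finrank k ((F l).restrictScalars k) := by
  intro l
  induction l with
  | zero => simp
  | succ l ih =>
    intro hl
    obtain ⟨hg1, -, hg3, -⟩ := hg l hl
    rw [Finset.sum_range_succ]
    refine (Nat.add_le_add_right (ih (by omega)) _).trans ?_
    let S : Set (QPath V) := {p | IsLower num p ∧ num p.src = i l}
    let ρ : pathSpan k R S →ₗ[k] MonomialAlgebra k R :=
      (LinearMap.mulRight k (g l)).domRestrict (pathSpan k R S)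
    have hρ : ∀ z : pathSpan k R S, (z : MonomialAlgebra k R) * g l ∈ F l → z = 0 := by
      rintro ⟨z, hz⟩ h
      rw [hg3] at h
      have h1 : z * vertexIdem k R num (i l) = z := by
        clear h
        induction hz using Submodule.span_induction with
        | mem z hz =>
          obtain ⟨p, ⟨-, hp⟩, rfl⟩ := hz
          rw [← hp, pathClass_mul_vertexIdem]
        | zero => rw [zero_mul]
        | add x y _ _ hx hy => rw [add_mul, hx, hy]
        | smul c x _ hx => rw [smul_mul_assoc, hx]
      rw [h1] at h
      have hdisj : Disjoint (pathSpan k R S) (pathSpan k R {p | RisesAbove num (i l) p}) := by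
        refine disjoint_pathSpan (Set.disjoint_left.mpr ?_)
        rintro p ⟨hp, hp'⟩ hr
        rw [isLower_iff, hp'] at hp
        exact hp hr
      exact Subtype.ext (Submodule.disjoint_def.mp hdisj z hz h)
    have hinj : Function.Injective ρ := by
      rw [injective_iff_map_eq_zero]
      intro z hz
      refine hρ z ?_
      change (z : MonomialAlgebra k R) * g l = 0 at hz
      rw [hz]
      exact zero_mem _
    have hdisj : Disjoint ((F l).restrictScalars k) (LinearMap.range ρ) := by
      rw [Submodule.disjoint_def]
      rintro _ hx ⟨z, rfl⟩
      rw [hρ z hx, map_zero]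
    have hle : (F l).restrictScalars k ⊔ LinearMap.range ρ ≤ (F (l + 1)).restrictScalars k := by
      refine sup_le (hF l hl) ?_
      rintro _ ⟨z, rfl⟩
      exact (F (l + 1)).smul_mem _ hg1
    have h1 := Submodule.finrank_mono hle
    have h2 := Submodule.finrank_sup_add_finrank_inf_eq ((F l).restrictScalars k)
      (LinearMap.range ρ)
    rw [hdisj.eq_bot, finrank_bot, LinearMap.finrank_range_of_inj hinj, finrank_pathSpan] at h2
    change _ + Nat.card {p : {p // IsGood k R p} // p.1 ∈ S} ≤ _
    omega

/-- The composition of a record path and of a lower path. -/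
def lowerCompRecord (x : Σ j, LowerFrom k R num j × RecordTo k R num j) : QPath V :=
  compOf x.2.1.1.1 x.2.2.1.1 (num.injective (x.2.2.2.2.trans x.2.1.2.2.symm))

/-- Numerical consequence of the existence of a standard filtration. -/
theorem card_lower_record_le [FiniteDimensional k (MonomialAlgebra k R)]
    (hR : ∀ p ∈ R, 2 ≤ p.length) (hqh : IsQuasiHereditary k (vertexIdem k R num)) :
    Nat.card (Σ j, LowerFrom k R num j × RecordTo k R num j) ≤ Nat.card {p // IsGood k R p} := by
  classical
  have := finite_good (k := k) (R := R)
  rcases isEmpty_or_nonempty (Fin n) with hn | hn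
  · simp
  obtain ⟨m, F, h0, hm, hF⟩ := hqh.1
  have hex : ∀ l, ∃ (i : Fin n) (g : MonomialAlgebra k R), l < m →
      (g ∈ F (l + 1) ∧ vertexIdem k R num i * g = g ∧
      (∀ a, a * g ∈ F l ↔ a * vertexIdem k R num i ∈ highIdeal k R num i) ∧
      ∀ x ∈ F (l + 1), ∃ a, x - a * g ∈ F l) := by
    intro l
    by_cases hl : l < m
    · obtain ⟨-, i, ⟨θ⟩⟩ := hF l hl
      obtain ⟨g, hg⟩ := exists_generator_of_standard num hR θ
      exact ⟨i, g, fun _ => hg⟩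
    -- Beyond the filtration, index and generator are dummies; this is why the case of no vertices
    -- was split off.
    · exact ⟨hn.some, 0, fun h => absurd h hl⟩
  choose i g hg using hex
  have h1 := sum_card_lowerFrom_le num (fun l hl => (hF l hl).1) hg m le_rfl
  have h2 : ∀ j, Nat.card (RecordTo k R num j) ≤ ((Finset.range m).filter (i · = j)).card := by
    intro j
    refine card_recordTo_le num (g := g) j fun x => ?_
    exact vertexIdem_mul_mem_of_filtration num hR hqh h0 hg j m le_rfl x (by rw [hm]; trivial)
  have h3 : Module.finrank k ((F m).restrictScalars k) = Nat.card {p // IsGood k R p} := by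
    rw [hm, Submodule.restrictScalars_top, finrank_top,
      Module.finrank_eq_nat_card_basis (pathBasis k R)]
  have h4 : ∑ t ∈ Finset.range m, Nat.card (LowerFrom k R num (i t)) =
      ∑ j, ((Finset.range m).filter (i · = j)).card * Nat.card (LowerFrom k R num j) := by
    rw [← Finset.sum_fiberwise (Finset.range m) i]
    refine Finset.sum_congr rfl fun j _ => ?_
    rw [← smul_eq_mul, ← Finset.sum_const]
    refine Finset.sum_congr rfl fun t ht => ?_
    rw [(Finset.mem_filter.mp ht).2]
  rw [Nat.card_sigma, ← h3]
  refine le_trans ?_ (h4 ▸ h1)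
  refine Finset.sum_le_sum fun j _ => ?_
  rw [Nat.card_prod, mul_comm]
  exact Nat.mul_le_mul_right _ (h2 j)

/-- In a quasi-hereditary monomial algebra, the composition of a nonzero record path with a nonzero
lower path is nonzero. -/
theorem IsGood.compOf [FiniteDimensional k (MonomialAlgebra k R)]
    (hR : ∀ p ∈ R, 2 ≤ p.length) (hqh : IsQuasiHereditary k (vertexIdem k R num)) {q r : QPath V}
    (hq : IsGood k R q) (hr : IsGood k R r) (hq' : IsLower num q) (hr' : IsRecord num r)
    (h : r.tgt = q.src) : IsGood k R (QPath.compOf q r h) := by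
  have := finite_good (k := k) (R := R)
  have hex : ∀ p : {p // IsGood k R p}, ∃ x : Σ j, LowerFrom k R num j × RecordTo k R num j,
      lowerCompRecord num x = p.1 := by
    rintro ⟨p, hp⟩
    obtain ⟨a, b, hab, rfl, ha, hb⟩ := exists_lower_record num p
    exact ⟨⟨num a.src, ⟨⟨a, hp.of_compOf_left⟩, ha, rfl⟩,
      ⟨⟨b, hp.of_compOf_right⟩, hb, congrArg num hab⟩⟩, rfl⟩
  choose σ hσ using hex
  have hinj : Function.Injective σ := fun p p' hpp => Subtype.ext (by rw [← hσ, ← hσ, hpp])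
  -- Factorization embeds the nonzero paths into the pairs, and the filtration bounds the number of
  -- pairs by the number of paths. So each pair is the factorization of a nonzero path, namely of
  -- its composite.
  have hbij := hinj.bijective_of_nat_card_le (card_lower_record_le num hR hqh)
  obtain ⟨p, hp⟩ := hbij.2 ⟨num q.src, ⟨⟨q, hq⟩, hq', rfl⟩, ⟨⟨r, hr⟩, hr', congrArg num h⟩⟩
  have := hσ p
  rw [hp] at this
  change QPath.compOf q r h = p.1 at this
  rw [this]
  exact p.2

end Counting

/-! ### `A` as a right module over `B_min`, and the exact Borel property -/

section Borel

open QPath TensorProduct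

variable {k : Type u} [Field k] {V : Type v} [Quiver.{w} V] [Fintype V] {R : Set (QPath V)}
  {n : ℕ} (num : V ≃ Fin n) [FiniteDimensional k (MonomialAlgebra k R)]
  (hR : ∀ p ∈ R, 2 ≤ p.length)

variable (k R) in
/-- The nonzero paths that stay below their source. -/
abbrev LowerPath : Type _ := {q : QPath V // IsGood k R q ∧ IsLower num q}

theorem finite_lowerPath : Finite (LowerPath k R num) := by
  have := finite_good (k := k) (R := R)
  refine Finite.of_injective
    (fun q : LowerPath k R num => (⟨q.1, q.2.1⟩ : {p // IsGood k R p})) fun q q' h => ?_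
  exact Subtype.ext (congrArg (fun p : {p // IsGood k R p} => p.1) h)

include hR in
theorem pathClass_record_mem_Bmin {r : QPath V} (hr : IsRecord num r) :
    pathClass k R r ∈ Bmin k R num := by
  rw [mem_Bmin_iff num hR]
  exact pathClass_mem_pathSpan hr

open Classical in
/-- The coordinate in `B` of an element of `A` that belongs to a lower path. -/
noncomputable def lowerCoord (q : LowerPath k R num) :
    MonomialAlgebra k R →ₗ[k] Bmin k R num :=
  (pathBasis k R).constr k fun p =>
    if (exists_lower_record num p.1).choose = q.1 then
      ⟨_, pathClass_record_mem_Bmin num hR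
        (exists_lower_record num p.1).choose_spec.choose_spec.choose_spec.2.2⟩
    else 0

open Classical in
-- If `r` is nonzero, so is the composite by quasi-heredity; it is then a basis vector, and
-- uniqueness of the factorization identifies the chosen parts. If `r` vanishes in `A`, so do both
-- sides.
theorem lowerCoord_pathClass (hqh : IsQuasiHereditary k (vertexIdem k R num))
    (q : LowerPath k R num) {a r : QPath V} (ha : IsGood k R a) (ha' : IsLower num a)
    (hr : IsRecord num r) (h : r.tgt = a.src) :
    (lowerCoord num hR q (pathClass k R (compOf a r h)) : MonomialAlgebra k R) =
      if a = q.1 then pathClass k R r else 0 := by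
  by_cases hg : IsGood k R r
  · have hgood := ha.compOf num hR hqh hg ha' hr h
    have h1 : pathClass k R (compOf a r h) = pathBasis k R ⟨_, hgood⟩ := 
      (pathBasis_apply (⟨_, hgood⟩ : {p // IsGood k R p})).symm
    rw [h1, lowerCoord, Module.Basis.constr_basis]
    have hspec := (exists_lower_record num (compOf a r h)).choose_spec.choose_spec.choose_spec
    obtain ⟨h2, h3⟩ := lower_record_unique hspec.1 hspec.2.1 hspec.2.2 ha' hr
    dsimp only
    split_ifs with h4 h5 h5
    · exact congrArg (pathClass k R) h3
    · exact absurd (h2.symm.trans h4) h5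
    · exact absurd (h2.trans h5) h4
    · rfl
  · have h0 : pathClass k R r = 0 := not_not.mp hg
    rw [← pathClass_mul, h0, mul_zero, map_zero, ite_self]
    rfl

/-- Multiplying `ar` on the right by a record path `s` changes only the record part, to `rs`.
Linearity would fail if `a(rs)` could vanish with `rs` and `ar` nonzero; quasi-heredity excludes
this. -/
theorem isDualBasis_lowerCoord (hqh : IsQuasiHereditary k (vertexIdem k R num))
    [Fintype (LowerPath k R num)] :
    IsDualBasis (B := Bmin k R num) (fun q : LowerPath k R num => pathClass k R q.1)
      (fun q => (lowerCoord num hR q).toAddMonoidHom) where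
  map_mul q a b := by
    change lowerCoord num hR q (a * b) = lowerCoord num hR q a * b
    obtain ⟨b, hb⟩ := b
    refine Subtype.ext ?_
    change (lowerCoord num hR q (a * b) : MonomialAlgebra k R) = lowerCoord num hR q a * b
    rw [mem_Bmin_iff num hR] at hb
    have ha : a ∈ pathSpan k R Set.univ := by rw [pathSpan_univ]; trivial
    induction ha using Submodule.span_induction with
    | mem a ha =>
      obtain ⟨p, -, rfl⟩ := ha
      by_cases hg : IsGood k R p
      · obtain ⟨a, r, h, rfl, ha, hr⟩ := exists_lower_record num p
        induction hb using Submodule.span_induction with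
        | mem b hb =>
          obtain ⟨s, hs, rfl⟩ := hb
          rw [lowerCoord_pathClass num hR hqh q hg.of_compOf_left ha hr]
          by_cases hsr : s.tgt = r.src
          · rw [pathClass_mul (compOf a r h) s hsr, compOf_assoc a r s h hsr]
            refine (lowerCoord_pathClass num hR hqh q hg.of_compOf_left ha (hr.compOf hs hsr)
              h).trans ?_
            split_ifs
            · rw [pathClass_mul]
            · rw [zero_mul]
          · rw [pathClass_mul_of_ne (p := compOf a r h) hsr, map_zero]
            split_ifs
            · rw [pathClass_mul_of_ne hsr]; rfl
            · rw [zero_mul]; rfl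
        | zero => rw [mul_zero, mul_zero, map_zero]; rfl
        | add x y _ _ hx hy => rw [mul_add, mul_add, map_add, ← hx, ← hy]; rfl
        | smul c x _ hx => rw [mul_smul_comm, mul_smul_comm, map_smul, ← hx]; rfl
      · rw [not_not.mp hg, zero_mul, map_zero]
        exact (zero_mul b).symm
    | zero =>
      rw [zero_mul, map_zero]
      exact (zero_mul b).symm
    | add x y _ _ hx hy =>
      rw [add_mul, map_add, map_add]
      exact (congrArg₂ _ hx hy).trans (add_mul _ _ b).symm
    | smul c x _ hx =>
      rw [smul_mul_assoc, map_smul, map_smul]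
      exact (congrArg _ hx).trans (smul_mul_assoc c _ b).symm
  sum_eq a := by
    classical
    change ∑ q : LowerPath k R num,
      pathClass k R q.1 * (lowerCoord num hR q a : MonomialAlgebra k R) = a
    have ha : a ∈ pathSpan k R Set.univ := by rw [pathSpan_univ]; trivial
    induction ha using Submodule.span_induction with
    | mem a ha =>
      obtain ⟨p, -, rfl⟩ := ha
      by_cases hg : IsGood k R p
      · obtain ⟨a, r, h, rfl, ha, hr⟩ := exists_lower_record num p
        simp only [lowerCoord_pathClass num hR hqh _ hg.of_compOf_left ha hr]
        rw [Finset.sum_eq_single ⟨a, hg.of_compOf_left, ha⟩]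
        · rw [if_pos rfl, pathClass_mul]
        · intro q _ hq
          rw [if_neg (fun h => hq (Subtype.ext h.symm)), mul_zero]
        · simp
      · rw [not_not.mp hg]; simp
    | zero => simp
    | add x y _ _ hx hy =>
      conv_rhs => rw [← hx, ← hy]
      simp [mul_add, Finset.sum_add_distrib]
    | smul c x _ hx =>
      conv_rhs => rw [← hx]
      simp [Finset.smul_sum]

omit [FiniteDimensional k (MonomialAlgebra k R)] in
theorem mul_vertexIdem_mem_highIdeal {z : MonomialAlgebra k R}
    (hz : z ∈ pathSpan k R (recordPaths num ∩ {p | 0 < p.length})) (i : Fin n) :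
    z * vertexIdem k R num i ∈ highIdeal k R num i := by
  induction hz using Submodule.span_induction with
  | mem z hz =>
    obtain ⟨p, ⟨hp, hl⟩, rfl⟩ := hz
    by_cases h : num p.src = i
    · rw [← h, pathClass_mul_vertexIdem]
      exact pathClass_mem_pathSpan (risesAbove_of_tgt (IsRecord.src_lt hp hl))
    · rw [pathClass_mul_vertexIdem_of_ne num h]
      exact zero_mem _
  | zero => rw [zero_mul]; exact zero_mem _
  | add x y _ _ hx hy => rw [add_mul]; exact add_mem hx hy
  | smul c x _ hx =>
    rw [smul_mul_assoc]
    exact Submodule.smul_mem (pathSpan k R _) c hx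

/-- A path from `i` that rises above `i` has a nontrivial record part. This part lies in the radical
of `B`, so it kills the simple module once moved across the tensor sign. -/
theorem mkQ_mul_tmul_eq_zero {L : Type*} [AddCommGroup L] [Module (Bmin k R num) L]
    [IsSimpleModule (Bmin k R num) L] {i : Fin n} {x : L}
    (hx : (⟨_, vertexIdem_mem_Bmin num hR i⟩ : Bmin k R num) • x = x) (h0 : x ≠ 0)
    {z : MonomialAlgebra k R} (hz : z ∈ highIdeal k R num i) :
    (inducedRel (Bmin k R num) L).mkQ ((z * vertexIdem k R num i) ⊗ₜ x) = 0 := by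
  rw [mem_highIdeal] at hz
  induction hz using Submodule.span_induction with
  | mem z hz =>
    obtain ⟨p, hp, rfl⟩ := hz
    by_cases h : num p.src = i
    · subst h
      rw [pathClass_mul_vertexIdem]
      obtain ⟨a, r, h, rfl, ha, hr⟩ := exists_lower_record num p
      have hl : 0 < r.length := by
        refine Nat.pos_of_ne_zero fun hl => ?_
        have h1 := eq_triv_of_length_eq_zero r hl
        rw [isLower_iff] at ha
        apply ha
        have h2 : compOf a r h = a := by
          have h3 : r.src = a.src := (src_eq_tgt_of_length_eq_zero hl).trans h
          clear hp hx
          generalize r.src = b at h1 h3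
          subst h1
          exact compOf_triv _ _ _
        have h3 : (compOf a r h).src = a.src := by rw [h2]
        rw [Set.mem_ofPred_eq, h3, h2] at hp
        exact hp
      have hB := pathClass_record_mem_Bmin (k := k) num hR hr
      have h1 := Induced.mk_mul_tmul (pathClass k R a) (⟨_, hB⟩ : Bmin k R num) x
      rw [← pathClass_mul a r h]
      rw [h1, (isSplitBasic_Bmin num hR).smul_eq_zero_of_mem hx h0, tmul_zero, map_zero]
      rw [mem_pathRadical]
      exact pathClass_mem_pathSpan ⟨hr, hl⟩
    · rw [pathClass_mul_vertexIdem_of_ne num h, zero_tmul, map_zero]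
  | zero => rw [zero_mul, zero_tmul, map_zero]
  | add x y _ _ hx hy => rw [add_mul, add_tmul, map_add, hx, hy, add_zero]
  | smul c z _ hz =>
    rw [smul_mul_assoc, Algebra.smul_def, ← smul_eq_mul, ← smul_tmul', map_smul, hz, smul_zero]

/-- Inducing a simple module of the subalgebra gives a standard module. -/
theorem exists_induced_equiv (hqh : IsQuasiHereditary k (vertexIdem k R num)) {L : Type*}
    [AddCommGroup L] [Module (Bmin k R num) L] [IsSimpleModule (Bmin k R num) L] {i : Fin n} {x : L}
    (hx : (⟨_, vertexIdem_mem_Bmin num hR i⟩ : Bmin k R num) • x = x) (h0 : x ≠ 0) :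
    Nonempty (Induced (Bmin k R num) L ≃ₗ[MonomialAlgebra k R]
      standardMod (vertexIdem k R num) i) := by
  have hb := isSplitBasic_Bmin (k := k) num hR
  have hA := isSplitBasic_monomialAlgebra (k := k) num hR
  have := finite_lowerPath (k := k) (R := R) num
  have := Fintype.ofFinite (LowerPath k R num)
  have hd := isDualBasis_lowerCoord num hR hqh
  let π : projMod (vertexIdem k R num i) →ₗ[MonomialAlgebra k R] Induced (Bmin k R num) L :=
    IsSplitBasic.projMap _ ((inducedRel (Bmin k R num) L).mkQ (1 ⊗ₜ x))
  have hπ : ∀ a, π a = (inducedRel (Bmin k R num) L).mkQ ((a : MonomialAlgebra k R) ⊗ₜ x) := by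
    intro a
    rw [IsSplitBasic.projMap_apply, ← map_smul, smul_tmul', smul_eq_mul, mul_one]
  -- If `a ⊗ x = 0`, every coordinate `b` of `a` kills `x`, so `b e_i` is a combination of
  -- nontrivial record paths. Those starting in `i` end above `i`, which puts `a` into `highIdeal`.
  have hker : LinearMap.ker π = standardKernel (vertexIdem k R num) i := by
    rw [standardKernel_eq num hR]
    ext a
    rw [LinearMap.mem_ker, hπ]
    constructor
    · intro h
      rw [hd.mkQ_eq_zero_iff] at h
      change (a : MonomialAlgebra k R) ∈ highIdeal k R num i
      rw [← hA.mul_eq_of_mem_projMod a.2, ← hd.sum_eq a, Finset.sum_mul]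
      refine sum_mem fun q _ => ?_
      rw [mul_assoc]
      refine Ideal.mul_mem_left _ _ ?_
      set b := lowerCoord num hR q (a : MonomialAlgebra k R)
      have hbx : b • x = 0 := h q
      have h2 : (b : MonomialAlgebra k R) * vertexIdem k R num i ∈
        pathSpan k R (recordPaths num ∩ {p | 0 < p.length}) :=
        hb.mul_mem_of_smul_eq_zero hx h0 hbx
      have h3 := mul_vertexIdem_mem_highIdeal num h2 i
      rwa [mul_assoc, hA.mul_self] at h3
    · intro h
      rw [← hA.mul_eq_of_mem_projMod a.2]
      exact mkQ_mul_tmul_eq_zero num hR hx h0 h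
  have hsurj : Function.Surjective π := by
    intro y
    obtain ⟨y, rfl⟩ := Submodule.mkQ_surjective _ y
    change _ ∈ LinearMap.range π
    induction y with
    | zero => rw [map_zero]; exact zero_mem _
    | add y z hy hz => rw [map_add]; exact add_mem hy hz
    | tmul a m =>
      obtain ⟨c, rfl⟩ := hb.exists_smul_eq hx h0 m
      refine ⟨⟨(a * algebraMap k _ c) * vertexIdem k R num i,
        IsSplitBasic.mem_projMod.mpr ⟨_, rfl⟩⟩, ?_⟩
      rw [hπ]
      refine (Induced.mk_mul_tmul (a * algebraMap k _ c)
        (⟨_, vertexIdem_mem_Bmin num hR i⟩ : Bmin k R num) x).trans ?_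
      rw [hx]
      exact Induced.mk_mul_tmul a (algebraMap k (Bmin k R num) c) x
  exact ⟨((Submodule.quotEquivOfEq _ _ hker.symm).trans (π.quotKerEquivOfSurjective hsurj)).symm⟩

omit [FiniteDimensional k (MonomialAlgebra k R)] in
theorem lt_of_vertexIdem_mul_ne_zero {i j : Fin n} {z : MonomialAlgebra k R}
    (hz : z ∈ pathSpan k R (recordPaths num ∩ {p | 0 < p.length}))
    (h : vertexIdem k R num j * z * vertexIdem k R num i ≠ 0) : i < j := by
  by_contra hij
  apply h
  clear h
  induction hz using Submodule.span_induction with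
  | mem z hz =>
    obtain ⟨p, ⟨hp, hl⟩, rfl⟩ := hz
    by_cases h1 : num p.tgt = j
    · by_cases h2 : num p.src = i
      · subst h1 h2
        exact absurd (IsRecord.src_lt hp hl) hij
      · rw [mul_assoc, pathClass_mul_vertexIdem_of_ne num h2, mul_zero]
    · rw [vertexIdem_mul_pathClass_of_ne num h1, zero_mul]
  | zero => rw [mul_zero, zero_mul]
  | add x y _ _ hx hy => rw [mul_add, add_mul, hx, hy, add_zero]
  | smul c x _ hx => rw [mul_smul_comm, smul_mul_assoc, hx, smul_zero]

include hR in
open scoped ModuleCat in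
theorem isExactBorel_Bmin (hqh : IsQuasiHereditary k (vertexIdem k R num)) :
    IsExactBorel (Bmin k R num) (vertexIdem k R num) := by
  have hb := isSplitBasic_Bmin (k := k) num hR
  have hA := isSplitBasic_monomialAlgebra (k := k) num hR
  have := finite_lowerPath (k := k) (R := R) num
  have := Fintype.ofFinite (LowerPath k R num)
  -- The bijection matches the simple modules of `B` and of `A` that belong to the same vertex.
  refine ⟨(isDualBasis_lowerCoord num hR hqh).inductionExact,
    hb.simEquiv.symm.trans hA.simEquiv, ?_⟩
  have key : ∀ (L : SimpleMod (Bmin k R num)) (S : SimpleMod (MonomialAlgebra k R)),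
      (hb.simEquiv.symm.trans hA.simEquiv) L.cls = S.cls →
      ∃ i, Nonempty (L.1 ≃ₗ[Bmin k R num]
          topMod (⟨_, vertexIdem_mem_Bmin num hR i⟩ : Bmin k R num)) ∧
        Nonempty (S.1 ≃ₗ[MonomialAlgebra k R] topMod (vertexIdem k R num i)) := by
    intro L S h
    refine ⟨hb.simEquiv.symm L.cls, ?_, ?_⟩
    · exact (hb.simEquiv_eq_cls_iff _ L).mp (Equiv.apply_symm_apply _ _)
    · exact (hA.simEquiv_eq_cls_iff _ S).mp h
  refine ⟨?_, ?_, ?_⟩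
  · intro L S h
    obtain ⟨i, ⟨φ⟩, hS⟩ := key L S h
    obtain ⟨x, hx, h0⟩ := hb.exists_generator_of_equiv φ
    have := L.2
    exact ⟨i, hS, exists_induced_equiv num hR hqh hx h0⟩
  · intro L S _
    have := L.2
    have := S.2
    have h1 := hb.end_algebraMap_bijective (M := L.1)
    have h2 := hA.end_algebraMap_bijective (M := S.1)
    exact ⟨(AlgEquiv.ofBijective (Algebra.ofId k _) h1).symm.trans
      (AlgEquiv.ofBijective (Algebra.ofId k _) h2)⟩
  · intro L L' S S' h h' hE
    obtain ⟨i, ⟨φ⟩, hS⟩ := key L S h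
    obtain ⟨j, ⟨φ'⟩, hS'⟩ := key L' S' h'
    -- A nonzero extension group gives a radical element of `B` with nonzero component in `e_j B
    -- e_i`; nontrivial record paths strictly climb, so even `i < j`.
    obtain ⟨a, ha, hne⟩ := hb.exists_mul_ne_zero_of_ext L L' φ φ' hE
    have hlt : i < j := lt_of_vertexIdem_mul_ne_zero num ha
      fun h => hne (Subtype.ext h)
    exact ⟨i, j, hlt.le, hS, hS'⟩

end Borel

theorem theorem3p5 {k : Type u} [Field k] {V : Type v} [Quiver.{w} V] [Fintype V]
    {n : ℕ} (num : V ≃ Fin n) (R : Set (QPath V)) (hR : ∀ p ∈ R, 2 ≤ p.length)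
    (hfin : FiniteDimensional k (MonomialAlgebra k R))
    (hqh : IsQuasiHereditary k (vertexIdem k R num)) :
    IsExactBorel (Bmin k R num) (vertexIdem k R num) ∧ HasPathBasis k R (Bmin k R num) :=
  ⟨isExactBorel_Bmin num hR hqh, hasPathBasis_Bmin num hR⟩
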